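/- Notation. For an integer $K\ge 0$ put $\Lambda_K=\{(m,n)\in\mathbb N_0^2: m+n\le K\}$ and $\Lambda_K^{V,1}=\{(m,n)\in\Lambda_K: m\in\{0,1\}\}$. Fix an integer $M\ge 1$. Setting. Let $\Omega=(l_1,l_2)\times(l_3,l_4)$, let $\psi$ be continuous on $\Omega$, and put $\Omega^{\pm}=\{p\in\Omega:\pm\psi(p)>0\}$, $\Gamma_I=\{p\in\Omega:\psi(p)=0\}$. Assume that near each of its points $\Gamma_I$ is an embedded $C^1$ curve with $\Omega^+$ on one side and $\Omega^-$ on the other (for example, $\psi$ is smooth with $\nabla\psi\ne0$ on $\Gamma_I$), and let $\vec n$ be its unit normal pointing towards $\Omega^+$. Let $a$, $u$ and $f$ have uniformly continuous partial derivatives of total orders up to $M$, $M+1$ and $M-1$, respectively, in each of $\Omega^+$ and $\Omega^-$, let $a>0$ in $\Omega\setminus\Gamma_I$, and let both one-sided limits of $a$ be positive at every point of $\Gamma_I$. Assume that $$-\nabla\cdot(a\nabla u)=f\ \text{ in }\Omega\setminus\Gamma_I,\qquad [u]=g_D,\quad [a\nabla u\cdot\vec n]=g_N\ \text{ on }\Gamma_I,$$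 where $[\,\cdot\,]$ is the limit from $\Omega^+$ minus the limit from $\Omega^-$ (no condition on $\partial\Omega$ is needed). Let $(x^*,y^*)\in\Gamma_I$, and let $g_D$ and $g_N$ be functions on the plane that are $C^{M+1}$ and $C^M$, respectively, near $(x^*,y^*)$. Let $t\mapsto(x^*+r(t),y^*+s(t))\in\Gamma_I$, $t\in(-\epsilon,\epsilon)$, $\epsilon>0$, be a $C^{M+1}$ parametrization with $r(0)=s(0)=0$ and $(r')^2+(s')^2>0$, and let $\sigma\in\{1,-1\}$ be the sign for which $\vec n(x^*,y^*)=\sigma\,(s'(0),-r'(0))/\sqrt{r'(0)^2+s'(0)^2}$. Write $g_D^{(m,n)}$ and $g_N^{(m,n)}$ for the values at $(x^*,y^*)$ of the derivatives $\partial^{m+n}/\partial x^m\partial y^n$ of $g_D$ and $g_N$, and $a_\pm^{(m,n)},u_\pm^{(m,n)},f_\pm^{(m,n)}$ for the limits at $(x^*,y^*)$, from within $\Omega^\pm$, of the corresponding derivatives of $a,u,f$. Theorem. There are real coefficients $T^{u_+}_{m',n',m,n}$, $T^{+}_{m',n',m,n}$, $T^{-}_{m',n',m,n}$, $T^{g_D}_{m',n',m,n}$,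 $T^{g_N}_{m',n',m,n}$ that are functions only of the numbers $r^{(k)}(0),s^{(k)}(0)$ $(k=0,\dots,M+1)$ and $a_\pm^{(m,n)}$ $((m,n)\in\Lambda_M)$, the same functions for all problems, base points and parametrizations as above, such that for all $(m',n')\in\Lambda_{M+1}^{V,1}$ $$\begin{aligned}u_-^{(m',n')}={}&\sum_{\substack{(m,n)\in\Lambda_{M+1}^{V,1}\\ m+n\le m'+n'}}T^{u_+}_{m',n',m,n}\,u_+^{(m,n)}+\sum_{(m,n)\in\Lambda_{M-1}}\bigl(T^+_{m',n',m,n}\,f_+^{(m,n)}+T^-_{m',n',m,n}\,f_-^{(m,n)}\bigr)\\&+\sum_{(m,n)\in\Lambda_{M+1}}T^{g_D}_{m',n',m,n}\,g_D^{(m,n)}+\sigma\sum_{(m,n)\in\Lambda_M}T^{g_N}_{m',n',m,n}\,g_N^{(m,n)}.\end{aligned}$$ Moreover, for $(m,n),(m',n')\in\Lambda_{M+1}^{V,1}$ with $m+n=m'+n'$, the coefficient $T^{u_+}_{m',n',m,n}$ depends only on $r^{(k)}(0),s^{(k)}(0)$ $(k=0,\dots,M+1)$ and on $a_+^{(0,0)},a_-^{(0,0)}$.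 In particular, $T^{u_+}_{0,0,0,0}=1$, and $T^{u_+}_{m',n',0,0}=0$ for all $(m',n')\in\Lambda_{M+1}^{V,1}$ with $(m',n')\ne(0,0)$. -/

import Mathlib

open Filter Topology

noncomputable section

namespace EllipticInterface

/-! ### Index sets -/

/-- `Λ_K`: all pairs `(m, n)` of nonnegative integers with `m + n ≤ K`. -/
def Lam (K : ℕ) : Finset (ℕ × ℕ) :=
  (Finset.range (K + 1)).biUnion fun k => Finset.HasAntidiagonal.antidiagonal k

theorem mem_Lam {K : ℕ} {q : ℕ × ℕ} : q ∈ Lam K ↔ q.1 + q.2 ≤ K := by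
  simp [Lam]

/-- `Λ_K^{V,1}`: the pairs `(0, n)` with `n ≤ K` and the pairs `(1, n)` with `1 + n ≤ K`. -/
def LamV1 (K : ℕ) : Finset (ℕ × ℕ) := (Lam K).filter fun q => q.1 ≤ 1

theorem mem_LamV1 {K : ℕ} {q : ℕ × ℕ} : q ∈ LamV1 K ↔ q.1 + q.2 ≤ K ∧ q.1 ≤ 1 := by
  simp [LamV1, mem_Lam]

/-! ### Partial derivatives -/

/-- The partial derivative `∂F/∂x`. -/
def partialX (F : ℝ × ℝ → ℝ) : ℝ × ℝ → ℝ := fun p => deriv (fun x => F (x, p.2)) p.1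

/-- The partial derivative `∂F/∂y`. -/
def partialY (F : ℝ × ℝ → ℝ) : ℝ × ℝ → ℝ := fun p => deriv (fun y => F (p.1, y)) p.2

/-- The partial derivative `∂^{m+n} F / ∂x^m ∂y^n`, where `q = (m, n)`. -/
def pderiv (q : ℕ × ℕ) (F : ℝ × ℝ → ℝ) : ℝ × ℝ → ℝ := partialX^[q.1] (partialY^[q.2] F)

/-- `F` has uniformly continuous partial derivatives of total orders up to `k` in the open
set `S`. -/
def UniformlySmoothOn (k : ℕ) (F : ℝ × ℝ → ℝ) (S : Set (ℝ × ℝ)) : Prop :=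
  ContDiffOn ℝ k F S ∧ ∀ q ∈ Lam k, UniformContinuousOn (pderiv q F) S

/-- The limit of `F` at `p` from within `S`. -/
def limFrom (S : Set (ℝ × ℝ)) (F : ℝ × ℝ → ℝ) (p : ℝ × ℝ) : ℝ := limUnder (𝓝[S] p) F

/-! ### The interface problem -/

/-- `n` is the unit normal at `p` of the zero set of `ψ`, pointing towards `{ψ > 0}`. Near `p`,
the sets `{ψ > 0}` and `{ψ < 0}` are the two sides of an embedded `C¹` curve through `p`: they are
the sets `{φ > 0}` and `{φ < 0}` for a `C¹` function `φ` with nonvanishing gradient, which is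
normalized here to `∇φ(p) = n`. If `∇ψ(p) ≠ 0`, then `φ` can be a multiple of `ψ`. -/
def IsUnitNormal (ψ : ℝ × ℝ → ℝ) (p n : ℝ × ℝ) : Prop :=
  n.1 ^ 2 + n.2 ^ 2 = 1 ∧
    ∃ φ : ℝ × ℝ → ℝ, ContDiffAt ℝ 1 φ p ∧
      (∀ᶠ q in 𝓝 p, (0 < φ q ↔ 0 < ψ q) ∧ (φ q < 0 ↔ ψ q < 0)) ∧
      ∀ v : ℝ × ℝ, fderiv ℝ φ p v = n.1 * v.1 + n.2 * v.2

/-- The functions that enter the elliptic interface problem on the rectangle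
`(l₁, l₂) × (l₃, l₄)`. The values of `a`, `f`, `u` on the interface, and of `normal` off it, play
no role. -/
structure InterfaceData where
  /-- left end of the `x`-interval -/
  l₁ : ℝ
  /-- right end of the `x`-interval -/
  l₂ : ℝ
  /-- left end of the `y`-interval -/
  l₃ : ℝ
  /-- right end of the `y`-interval -/
  l₄ : ℝ
  /-- level set function of the interface -/
  ψ : ℝ × ℝ → ℝ
  /-- unit normal vector field of the interface -/
  normal : ℝ × ℝ → ℝ × ℝ
  /-- coefficient of the elliptic operator -/
  a : ℝ × ℝ → ℝ
  /-- source term -/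
  f : ℝ × ℝ → ℝ
  /-- solution -/
  u : ℝ × ℝ → ℝ
  /-- jump of the solution -/
  gD : ℝ × ℝ → ℝ
  /-- jump of the flux -/
  gN : ℝ × ℝ → ℝ

namespace InterfaceData

variable (P : InterfaceData)

/-- The rectangle `Ω`. -/
def domain : Set (ℝ × ℝ) := Set.Ioo P.l₁ P.l₂ ×ˢ Set.Ioo P.l₃ P.l₄

/-- The interface `Γ_I`. -/
def interface : Set (ℝ × ℝ) := {p ∈ P.domain | P.ψ p = 0}

/-- The subregion `Ω⁺`. -/
def regionPlus : Set (ℝ × ℝ) := {p ∈ P.domain | 0 < P.ψ p}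

/-- The subregion `Ω⁻`. -/
def regionMinus : Set (ℝ × ℝ) := {p ∈ P.domain | P.ψ p < 0}

/-- `F_+^{(m,n)}` at a point `p` of the interface: the limit of `∂^{m+n} F / ∂x^m ∂y^n` at `p`
from within `Ω⁺`. -/
def derivPlus (F : ℝ × ℝ → ℝ) (p : ℝ × ℝ) (q : ℕ × ℕ) : ℝ := limFrom P.regionPlus (pderiv q F) p

/-- `F_-^{(m,n)}` at a point `p` of the interface: the limit of `∂^{m+n} F / ∂x^m ∂y^n` at `p`
from within `Ω⁻`. -/
def derivMinus (F : ℝ × ℝ → ℝ) (p : ℝ × ℝ) (q : ℕ × ℕ) : ℝ := limFrom P.regionMinus (pderiv q F) p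

/-- The jump `[F]` at a point `p` of the interface. -/
def jump (F : ℝ × ℝ → ℝ) (p : ℝ × ℝ) : ℝ := limFrom P.regionPlus F p - limFrom P.regionMinus F p

/-- The interface problem: `Γ_I` is a curve that separates `Ω⁺` from `Ω⁻`, the coefficient `a` is
positive up to the interface, `a`, `u`, `f` are piecewise smooth of orders `M`, `M + 1`, `M - 1`,
`-∇ · (a ∇u) = f` in `Ω ∖ Γ_I`, and `[u] = g_D`, `[a ∇u · n] = g_N` on `Γ_I`. No condition is
imposed on the outer boundary of `Ω`. -/
structure IsSolution (M : ℕ) : Prop where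
  continuousOn_ψ : ContinuousOn P.ψ P.domain
  normal_spec : ∀ p ∈ P.interface, IsUnitNormal P.ψ p (P.normal p)
  a_pos : ∀ p ∈ P.domain \ P.interface, 0 < P.a p
  a_pos_interface : ∀ p ∈ P.interface,
    0 < limFrom P.regionPlus P.a p ∧ 0 < limFrom P.regionMinus P.a p
  a_plus : UniformlySmoothOn M P.a P.regionPlus
  a_minus : UniformlySmoothOn M P.a P.regionMinus
  u_plus : UniformlySmoothOn (M + 1) P.u P.regionPlus
  u_minus : UniformlySmoothOn (M + 1) P.u P.regionMinus
  f_plus : UniformlySmoothOn (M - 1) P.f P.regionPlus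
  f_minus : UniformlySmoothOn (M - 1) P.f P.regionMinus
  pde : ∀ p ∈ P.domain \ P.interface,
    -(partialX (fun z => P.a z * partialX P.u z) p
      + partialY (fun z => P.a z * partialY P.u z) p) = P.f p
  jump_u : ∀ p ∈ P.interface, P.jump P.u p = P.gD p
  jump_flux : ∀ p ∈ P.interface,
    P.jump (fun z => P.a z *
      (partialX P.u z * (P.normal p).1 + partialY P.u z * (P.normal p).2)) p = P.gN p

/-- `t ↦ (x* + r t, y* + s t)` is a regular parametrization, of class `C^{M+1}`, of the interface
near its point `p = (x*, y*)`, which has the parameter `t = 0`. -/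
def IsLocalParam (M : ℕ) (p : ℝ × ℝ) (r s : ℝ → ℝ) : Prop :=
  r 0 = 0 ∧ s 0 = 0 ∧ ∃ ε > 0,
    ContDiffOn ℝ (M + 1 : ℕ) r (Set.Ioo (-ε) ε) ∧ ContDiffOn ℝ (M + 1 : ℕ) s (Set.Ioo (-ε) ε) ∧
    ∀ t ∈ Set.Ioo (-ε) ε, 0 < deriv r t ^ 2 + deriv s t ^ 2 ∧ (p.1 + r t, p.2 + s t) ∈ P.interface

/-- The sign `±1` for which the unit normal at `p` is `±(s'(0), -r'(0)) / √(r'(0)² + s'(0)²)`: it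
is `1` if `Ω⁺` lies to the right of the parametrized curve and `-1` if it lies to the left. -/
def orientation (p : ℝ × ℝ) (r s : ℝ → ℝ) : ℝ :=
  Real.sign ((P.normal p).1 * deriv s 0 - (P.normal p).2 * deriv r 0)

end InterfaceData

/-! ### The data on which the transmission coefficients depend -/

/-- Possible values of `r^{(k)}(0)`, `s^{(k)}(0)` for `k = 0, …, M + 1` and of `a_±^{(m,n)}` for
`(m, n) ∈ Λ_M`. -/
structure Jet (M : ℕ) where
  /-- derivatives of `r` -/
  r : Fin (M + 2) → ℝ
  /-- derivatives of `s` -/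
  s : Fin (M + 2) → ℝ
  /-- derivatives of the coefficient on the positive side -/
  aPlus : {q // q ∈ Lam M} → ℝ
  /-- derivatives of the coefficient on the negative side -/
  aMinus : {q // q ∈ Lam M} → ℝ

/-- The index `(0, 0) ∈ Λ_M`. -/
def origin (M : ℕ) : {q // q ∈ Lam M} := ⟨(0, 0), mem_Lam.2 (Nat.zero_le _)⟩

/-- The values for an actual problem, a base point and a parametrization. -/
def InterfaceData.jet (P : InterfaceData) (M : ℕ) (p : ℝ × ℝ) (r s : ℝ → ℝ) : Jet M where
  r k := iteratedDeriv k r 0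
  s k := iteratedDeriv k s 0
  aPlus q := P.derivPlus P.a p q
  aMinus q := P.derivMinus P.a p q

end EllipticInterface

end

/-!
Differentiating `-∇ · (a ∇u) = f`, the jump of `u` and the jump of the flux along the interface
gives linear relations between the derivatives at `p` of `u_±`, `f_±`, `g_D`, `σ g_N`, with
coefficients that depend only on the `Jet`. By linear algebra it suffices to show that, on the
space of all solutions of these relations, `u_-^(q')` vanishes together with the data and with the
derivatives `u_+^(q)`, `q ∈ Λ^{V,1}`, `|q| ≤ |q'|`. If all derivatives of lower order are zero, then
those of order `K` form a harmonic polynomial `Re (c (y + i x)^K)`, and with `z = s'(0) + i r'(0)`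
the jump relations prescribe `Re (z^K c)` and `a Im (z^K c)`. Hence they determine `c` on the
negative side from `c` on the positive side, by a formula that involves only `z` and the ratio of
the two values of `a`; this is the coefficient of top order.
-/

noncomputable section

namespace EllipticInterface

/-! ### Calculus of derivatives at a point -/

/-- The derivatives at a point of `F'`, from those of `F`. -/
def shift (x : ℕ → ℝ) : ℕ → ℝ := fun k => x (k + 1)

/-- The derivatives at a point of `∂F/∂x`, from those of `F`. -/
def shiftX : (ℕ × ℕ → ℝ) →ₗ[ℝ] (ℕ × ℕ → ℝ) := LinearMap.funLeft ℝ ℝ fun q => (q.1 + 1, q.2)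

/-- The derivatives at a point of `∂F/∂y`, from those of `F`. -/
def shiftY : (ℕ × ℕ → ℝ) →ₗ[ℝ] (ℕ × ℕ → ℝ) := LinearMap.funLeft ℝ ℝ fun q => (q.1, q.2 + 1)

@[simp] theorem shift_apply (x : ℕ → ℝ) (k : ℕ) : shift x k = x (k + 1) := rfl

@[simp] theorem shiftX_apply (G : ℕ × ℕ → ℝ) (q : ℕ × ℕ) : shiftX G q = G (q.1 + 1, q.2) := rfl

@[simp] theorem shiftY_apply (G : ℕ × ℕ → ℝ) (q : ℕ × ℕ) : shiftY G q = G (q.1, q.2 + 1) := rfl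

/-- The derivatives at a point of a product of two functions of one variable. -/
def leibniz (x : ℕ → ℝ) : (ℕ → ℝ) →ₗ[ℝ] (ℕ → ℝ) :=
  LinearMap.pi fun k =>
    ∑ i ∈ Finset.range (k + 1), ((k.choose i : ℝ) * x i) • LinearMap.proj (k - i)

theorem leibniz_apply (x y : ℕ → ℝ) (k : ℕ) :
    leibniz x y k = ∑ i ∈ Finset.range (k + 1), (k.choose i : ℝ) * x i * y (k - i) := by
  simp [leibniz]

theorem leibniz_congr {x x' y y' : ℕ → ℝ} {k : ℕ} (hx : ∀ i ≤ k, x i = x' i)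
    (hy : ∀ i ≤ k, y i = y' i) : leibniz x y k = leibniz x' y' k := by
  simp only [leibniz_apply]
  refine Finset.sum_congr rfl fun i hi => ?_
  rw [hx i (Finset.mem_range_succ_iff.1 hi), hy _ (Nat.sub_le k i)]

theorem leibniz_eq_head {x y : ℕ → ℝ} {k : ℕ} (h : ∀ j < k, y j = 0) :
    leibniz x y k = x 0 * y k := by
  rw [leibniz_apply, Finset.sum_range_succ', Finset.sum_eq_zero]
  · simp
  · intro i hi
    rw [h _ (by have := Finset.mem_range.1 hi; omega), mul_zero]

theorem leibniz_eq_zero {x y : ℕ → ℝ} {k : ℕ} (h : ∀ j ≤ k, y j = 0) : leibniz x y k = 0 := by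
  rw [leibniz_eq_head fun j hj => h j hj.le, h k le_rfl, mul_zero]

/-- The derivatives at a point of a product of two functions of two variables. -/
def leibniz₂ (A : ℕ × ℕ → ℝ) : (ℕ × ℕ → ℝ) →ₗ[ℝ] (ℕ × ℕ → ℝ) :=
  LinearMap.pi fun q => ∑ i ∈ Finset.range (q.1 + 1), ∑ j ∈ Finset.range (q.2 + 1),
    ((q.1.choose i : ℝ) * q.2.choose j * A (i, j)) • LinearMap.proj (q.1 - i, q.2 - j)

theorem leibniz₂_apply (A B : ℕ × ℕ → ℝ) (q : ℕ × ℕ) :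
    leibniz₂ A B q = ∑ i ∈ Finset.range (q.1 + 1), ∑ j ∈ Finset.range (q.2 + 1),
      (q.1.choose i : ℝ) * q.2.choose j * A (i, j) * B (q.1 - i, q.2 - j) := by
  simp [leibniz₂]

theorem leibniz₂_eq_head {A B : ℕ × ℕ → ℝ} {q : ℕ × ℕ}
    (h : ∀ q' : ℕ × ℕ, q'.1 + q'.2 < q.1 + q.2 → B q' = 0) :
    leibniz₂ A B q = A (0, 0) * B q := by
  rw [leibniz₂_apply, Finset.sum_range_succ', Finset.sum_eq_zero, Finset.sum_range_succ',
    Finset.sum_eq_zero]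
  · simp
  · intro j hj
    rw [h _ (by have := Finset.mem_range.1 hj; dsimp only; omega), mul_zero]
  · intro i hi
    refine Finset.sum_eq_zero fun j _ => ?_
    rw [h _ (by have := Finset.mem_range.1 hi; dsimp only; omega), mul_zero]

theorem leibniz₂_congr {A B B' : ℕ × ℕ → ℝ} {q : ℕ × ℕ}
    (h : ∀ q' : ℕ × ℕ, q'.1 + q'.2 ≤ q.1 + q.2 → B q' = B' q') :
    leibniz₂ A B q = leibniz₂ A B' q := by
  simp only [leibniz₂_apply]
  refine Finset.sum_congr rfl fun i _ => Finset.sum_congr rfl fun j _ => ?_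
  rw [h _ (by dsimp only; omega)]

/-- The derivatives of `∇ · (a ∇u)` at a point, from those of `a` and `u`. -/
def ellipticJet (A : ℕ × ℕ → ℝ) : (ℕ × ℕ → ℝ) →ₗ[ℝ] (ℕ × ℕ → ℝ) :=
  shiftX ∘ₗ leibniz₂ A ∘ₗ shiftX + shiftY ∘ₗ leibniz₂ A ∘ₗ shiftY

theorem ellipticJet_apply (A U : ℕ × ℕ → ℝ) (q : ℕ × ℕ) :
    ellipticJet A U q = leibniz₂ A (shiftX U) (q.1 + 1, q.2)
      + leibniz₂ A (shiftY U) (q.1, q.2 + 1) := rfl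

/-- The `k`-th derivative of `t ↦ G (r t, s t)`, from the derivatives of `r`, `s` and `G`. -/
def traceDeriv (r s : ℕ → ℝ) : ℕ → ((ℕ × ℕ → ℝ) →ₗ[ℝ] ℝ)
  | 0 => LinearMap.proj (0, 0)
  | k + 1 => ∑ i : Fin (k + 1), (k.choose i : ℝ) •
      (shift r i • traceDeriv r s (k - i) ∘ₗ shiftX + shift s i • traceDeriv r s (k - i) ∘ₗ shiftY)
termination_by k => k

/-- The derivatives of `t ↦ G (r t, s t)`, from the derivatives of `r`, `s` and `G`. -/
def traceJet (r s : ℕ → ℝ) : (ℕ × ℕ → ℝ) →ₗ[ℝ] (ℕ → ℝ) := LinearMap.pi (traceDeriv r s)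

@[simp] theorem traceJet_zero (r s : ℕ → ℝ) (G : ℕ × ℕ → ℝ) : traceJet r s G 0 = G (0, 0) := by
  rw [traceJet, LinearMap.pi_apply, traceDeriv, LinearMap.proj_apply]

theorem traceJet_succ (r s : ℕ → ℝ) (G : ℕ × ℕ → ℝ) (k : ℕ) :
    traceJet r s G (k + 1) = leibniz (shift r) (traceJet r s (shiftX G)) k
      + leibniz (shift s) (traceJet r s (shiftY G)) k := by
  simp only [leibniz_apply, ← Finset.sum_add_distrib]
  rw [traceJet, LinearMap.pi_apply, traceDeriv, ← Fin.sum_univ_eq_sum_range fun i =>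
    (k.choose i : ℝ) * shift r i * LinearMap.pi (traceDeriv r s) (shiftX G) (k - i)
      + (k.choose i : ℝ) * shift s i * LinearMap.pi (traceDeriv r s) (shiftY G) (k - i)]
  simp [mul_assoc]

theorem traceJet_congr {r s r' s' : ℕ → ℝ} {G G' : ℕ × ℕ → ℝ} {k : ℕ} (hr : ∀ i ≤ k, r i = r' i)
    (hs : ∀ i ≤ k, s i = s' i) (hG : ∀ q : ℕ × ℕ, q.1 + q.2 ≤ k → G q = G' q) :
    traceJet r s G k = traceJet r' s' G' k := by
  induction k using Nat.strong_induction_on generalizing G G' with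
  | _ k ih =>
    cases k with
    | zero => simp [hG (0, 0) le_rfl]
    | succ k =>
      rw [traceJet_succ, traceJet_succ]
      congr 1 <;> refine leibniz_congr (fun i hi => ?_) fun i hi => ih i (by omega)
        (fun j hj => hr j (by omega)) (fun j hj => hs j (by omega)) fun q hq => hG _ ?_
      · exact hr _ (by omega)
      · dsimp only; omega
      · exact hs _ (by omega)
      · dsimp only; omega

theorem traceJet_eq_zero {r s : ℕ → ℝ} {G : ℕ × ℕ → ℝ} {k : ℕ}
    (hG : ∀ q : ℕ × ℕ, q.1 + q.2 ≤ k → G q = 0) : traceJet r s G k = 0 := by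
  rw [traceJet_congr (fun _ _ => rfl) (fun _ _ => rfl) (G' := 0) hG, map_zero, Pi.zero_apply]

/-- The derivatives of `a ∇u · (s', -r')` along the curve `(r, s)`, from those of `r`, `s`, `a`
and `u`. -/
def fluxJet (r s : ℕ → ℝ) (A : ℕ × ℕ → ℝ) : (ℕ × ℕ → ℝ) →ₗ[ℝ] (ℕ → ℝ) :=
  leibniz (traceJet r s A) ∘ₗ
    (leibniz (shift s) ∘ₗ traceJet r s ∘ₗ shiftX - leibniz (shift r) ∘ₗ traceJet r s ∘ₗ shiftY)

theorem fluxJet_apply (r s : ℕ → ℝ) (A U : ℕ × ℕ → ℝ) :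
    fluxJet r s A U = leibniz (traceJet r s A)
      (leibniz (shift s) (traceJet r s (shiftX U))
        - leibniz (shift r) (traceJet r s (shiftY U))) := rfl

/-- The derivatives of `√F` at a point where `F` is positive, from those of `F`; the recursion
solves `√F * √F = F` for the term of highest order. -/
def sqrtJet (x : ℕ → ℝ) : ℕ → ℝ
  | 0 => √(x 0)
  | k + 1 => (x (k + 1) - ∑ i : Fin k, ((k + 1).choose (i + 1) : ℝ) * sqrtJet x (i + 1)
      * sqrtJet x (k - i)) / (2 * √(x 0))
termination_by k => k

theorem sqrtJet_zero (x : ℕ → ℝ) : sqrtJet x 0 = √(x 0) := by rw [sqrtJet]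

theorem eq_sqrtJet {x v : ℕ → ℝ} {K : ℕ} (hx : 0 < x 0) (hv : v 0 = √(x 0))
    (h : ∀ k ≤ K, leibniz v v k = x k) {k : ℕ} (hk : k ≤ K) : v k = sqrtJet x k := by
  induction k using Nat.strong_induction_on with
  | _ k ih =>
    cases k with
    | zero => rw [hv, sqrtJet_zero]
    | succ k =>
      have hsum := h (k + 1) hk
      rw [leibniz_apply, Finset.sum_range_succ, Finset.sum_range_succ'] at hsum
      rw [sqrtJet, eq_div_iff (mul_ne_zero two_ne_zero (Real.sqrt_pos.2 hx).ne'),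
        Fin.sum_univ_eq_sum_range fun i => ((k + 1).choose (i + 1) : ℝ) * sqrtJet x (i + 1)
          * sqrtJet x (k - i), ← hsum]
      have hmid : ∑ i ∈ Finset.range k, ((k + 1).choose (i + 1) : ℝ) * v (i + 1)
            * v (k + 1 - (i + 1))
          = ∑ i ∈ Finset.range k, ((k + 1).choose (i + 1) : ℝ) * sqrtJet x (i + 1)
            * sqrtJet x (k - i) := by
        refine Finset.sum_congr rfl fun i hi => ?_
        have hi := Finset.mem_range.1 hi
        rw [ih (i + 1) (by omega) (by omega), Nat.add_sub_add_right,
          ih (k - i) (by omega) (by omega)]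
      rw [hmid, ← hv]
      simp
      ring

/-! ### Terms of highest order -/

/-- All derivatives of orders `1, …, K - 1` vanish. -/
def IsFlatBelow (K : ℕ) (G : ℕ × ℕ → ℝ) : Prop :=
  ∀ q : ℕ × ℕ, 0 < q.1 + q.2 → q.1 + q.2 < K → G q = 0

theorem IsFlatBelow.shiftX_eq_zero {K : ℕ} {G : ℕ × ℕ → ℝ} (h : IsFlatBelow (K + 1) G) (q : ℕ × ℕ)
    (hq : q.1 + q.2 < K) : shiftX G q = 0 :=
  h _ (by dsimp only; omega) (by dsimp only; omega)

theorem IsFlatBelow.shiftY_eq_zero {K : ℕ} {G : ℕ × ℕ → ℝ} (h : IsFlatBelow (K + 1) G) (q : ℕ × ℕ)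
    (hq : q.1 + q.2 < K) : shiftY G q = 0 :=
  h _ (by dsimp only; omega) (by dsimp only; omega)

/-- The derivatives of order `K` are those of the harmonic polynomial `Re (c (y + i x) ^ K) / K!`.
-/
def HasSymbol (K : ℕ) (G : ℕ × ℕ → ℝ) (c : ℂ) : Prop :=
  ∀ q : ℕ × ℕ, q.1 + q.2 = K → G q = (Complex.I ^ q.1 * c).re

theorem hasSymbol_shiftX {K : ℕ} {G : ℕ × ℕ → ℝ} {c : ℂ} (h : HasSymbol (K + 1) G c) :
    HasSymbol K (shiftX G) (Complex.I * c) := fun q hq => by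
  rw [shiftX_apply, h _ (by dsimp only; omega), pow_succ, mul_assoc]

theorem hasSymbol_shiftY {K : ℕ} {G : ℕ × ℕ → ℝ} {c : ℂ} (h : HasSymbol (K + 1) G c) :
    HasSymbol K (shiftY G) c := fun q hq => h _ (by dsimp only; omega)

theorem HasSymbol.eq_zero {K : ℕ} {G : ℕ × ℕ → ℝ} (h : HasSymbol K G 0) {q : ℕ × ℕ}
    (hq : q.1 + q.2 = K) : G q = 0 := by
  rw [h q hq, mul_zero, Complex.zero_re]

theorem IsFlatBelow.succ {K : ℕ} {G : ℕ × ℕ → ℝ} (h : IsFlatBelow K G)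
    (hK : 0 < K → HasSymbol K G 0) : IsFlatBelow (K + 1) G := fun q hq hqK => by
  rcases Nat.lt_succ_iff_lt_or_eq.1 hqK with hlt | heq
  · exact h q hq hlt
  · exact (hK (heq ▸ hq)).eq_zero heq

/-- The derivative `s'(0) + i r'(0)` of the curve `(r, s)` in the coordinate `y + i x`. -/
def tangent (r s : ℕ → ℝ) : ℂ := ⟨s 1, r 1⟩

theorem tangent_mul_re (r s : ℕ → ℝ) (c : ℂ) :
    (tangent r s * c).re = s 1 * c.re - r 1 * c.im := Complex.mul_re _ _

theorem tangent_mul_im (r s : ℕ → ℝ) (c : ℂ) :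
    (tangent r s * c).im = s 1 * c.im + r 1 * c.re := Complex.mul_im _ _

theorem HasSymbol.traceJet_eq {r s : ℕ → ℝ} {K : ℕ} {G : ℕ × ℕ → ℝ} {c : ℂ} (h : HasSymbol K G c)
    (hG : IsFlatBelow K G) : traceJet r s G K = (tangent r s ^ K * c).re := by
  induction K generalizing G c with
  | zero => simp [h (0, 0) rfl]
  | succ K ih =>
    rw [traceJet_succ,
      leibniz_eq_head fun j hj => traceJet_eq_zero fun q hq => hG.shiftX_eq_zero q (by omega),
      leibniz_eq_head fun j hj => traceJet_eq_zero fun q hq => hG.shiftY_eq_zero q (by omega),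
      ih (hasSymbol_shiftX h) fun q _ hq => hG.shiftX_eq_zero q hq,
      ih (hasSymbol_shiftY h) fun q _ hq => hG.shiftY_eq_zero q hq,
      pow_succ', mul_assoc, tangent_mul_re, mul_left_comm, Complex.I_mul_re]
    simp only [shift_apply]
    ring

theorem HasSymbol.fluxJet_eq {r s : ℕ → ℝ} {A : ℕ × ℕ → ℝ} {K : ℕ} {G : ℕ × ℕ → ℝ} {c : ℂ}
    (h : HasSymbol (K + 1) G c) (hG : IsFlatBelow (K + 1) G) :
    fluxJet r s A G K = -(A (0, 0) * (tangent r s ^ (K + 1) * c).im) := by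
  have hX (j) (hj : j < K) : traceJet r s (shiftX G) j = 0 :=
    traceJet_eq_zero fun q hq => hG.shiftX_eq_zero q (by omega)
  have hY (j) (hj : j < K) : traceJet r s (shiftY G) j = 0 :=
    traceJet_eq_zero fun q hq => hG.shiftY_eq_zero q (by omega)
  rw [fluxJet_apply, leibniz_eq_head, Pi.sub_apply, leibniz_eq_head hX, leibniz_eq_head hY,
    (hasSymbol_shiftX h).traceJet_eq fun q _ hq => hG.shiftX_eq_zero q hq,
    (hasSymbol_shiftY h).traceJet_eq fun q _ hq => hG.shiftY_eq_zero q hq,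
    traceJet_zero, pow_succ', mul_assoc, tangent_mul_im, mul_left_comm, Complex.I_mul_re]
  · simp only [shift_apply]
    ring
  · intro j hj
    rw [Pi.sub_apply, leibniz_eq_zero fun i hi => hX i (by omega),
      leibniz_eq_zero fun i hi => hY i (by omega), sub_zero]

theorem harmonic_of_ellipticJet {A U : ℕ × ℕ → ℝ} (hA : A (0, 0) ≠ 0) {q : ℕ × ℕ}
    (hU : IsFlatBelow (q.1 + q.2 + 2) U) (h : ellipticJet A U q = 0) :
    U (q.1 + 2, q.2) = -U (q.1, q.2 + 2) := by
  rw [ellipticJet_apply,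
    leibniz₂_eq_head fun q' hq' => hU.shiftX_eq_zero q' (by dsimp only at hq'; omega),
    leibniz₂_eq_head fun q' hq' => hU.shiftY_eq_zero q' (by dsimp only at hq'; omega),
    ← mul_add] at h
  exact eq_neg_of_add_eq_zero_left ((mul_eq_zero.1 h).resolve_left hA)

/-- The candidate `∂_y^K G - i ∂_x ∂_y^(K-1) G` for the symbol in order `K`. -/
def lead (K : ℕ) (G : ℕ × ℕ → ℝ) : ℂ :=
  ∑ q ∈ LamV1 K with q.1 + q.2 = K, G q • (-Complex.I) ^ q.1

theorem lead_zero (G : ℕ × ℕ → ℝ) : lead 0 G = G (0, 0) := by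
  have hfilter : (LamV1 0).filter (fun q => q.1 + q.2 = 0) = {(0, 0)} := by
    ext q
    simp only [Finset.mem_filter, mem_LamV1, Finset.mem_singleton, Prod.ext_iff]
    omega
  rw [lead, hfilter]
  simp

theorem lead_succ (K : ℕ) (G : ℕ × ℕ → ℝ) : lead (K + 1) G = ⟨G (0, K + 1), -G (1, K)⟩ := by
  have hfilter : (LamV1 (K + 1)).filter (fun q => q.1 + q.2 = K + 1) = {(0, K + 1), (1, K)} := by
    ext q
    simp only [Finset.mem_filter, mem_LamV1, Finset.mem_singleton, Finset.mem_insert, Prod.ext_iff]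
    omega
  rw [lead, hfilter, Finset.sum_pair (by simp)]
  apply Complex.ext <;> simp

theorem lead_eq_sum {K L : ℕ} (h : K ≤ L) (G : ℕ × ℕ → ℝ) :
    lead K G = ∑ q ∈ LamV1 L with q.1 + q.2 = K, G q • (-Complex.I) ^ q.1 := by
  have hfilter : (LamV1 K).filter (fun q => q.1 + q.2 = K)
      = (LamV1 L).filter (fun q => q.1 + q.2 = K) := by
    ext q
    simp only [Finset.mem_filter, mem_LamV1]
    omega
  rw [lead, hfilter]

theorem hasSymbol_lead {K : ℕ} {G : ℕ × ℕ → ℝ}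
    (hG : ∀ i j : ℕ, i + j + 2 = K → G (i + 2, j) = -G (i, j + 2)) : HasSymbol K G (lead K G) := by
  rintro ⟨i, j⟩ rfl
  induction i using Nat.strong_induction_on generalizing j with
  | _ i ih =>
    match i with
    | 0 => cases j <;> simp [lead_zero, lead_succ]
    | 1 => simp [add_comm 1 j, lead_succ]
    | i + 2 =>
      have hij := ih i (by omega) (j + 2)
      simp only [show i + (j + 2) = i + 2 + j by omega] at hij
      rw [hG i j (by dsimp only; omega), hij fun i' j' h => hG i' j' h]
      simp [pow_add]

theorem hasSymbol_of_ellipticJet {A U : ℕ × ℕ → ℝ} {K : ℕ} (hA : A (0, 0) ≠ 0)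
    (hU : IsFlatBelow K U) (h : ∀ q : ℕ × ℕ, q.1 + q.2 + 2 = K → ellipticJet A U q = 0) :
    HasSymbol K U (lead K U) :=
  hasSymbol_lead fun i j hij =>
    harmonic_of_ellipticJet hA (q := (i, j)) (by dsimp only; rwa [hij]) (h _ hij)

/-- The symbol `c'` with `Re (w c') = Re (w c)` and `Im (w c') = κ Im (w c)`. -/
def refract (κ : ℝ) (w : ℂ) : ℂ →ₗ[ℝ] ℂ where
  toFun c := w⁻¹ * ⟨(w * c).re, κ * (w * c).im⟩
  map_add' c d := by
    rw [← mul_add]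
    congr 1
    apply Complex.ext <;> simp <;> ring
  map_smul' x c := by
    rw [RingHom.id_apply, ← mul_smul_comm]
    congr 1
    apply Complex.ext <;> simp <;> ring

theorem refract_apply (κ : ℝ) (w c : ℂ) :
    refract κ w c = w⁻¹ * ⟨(w * c).re, κ * (w * c).im⟩ := rfl

theorem eq_refract {κ : ℝ} {w c c' : ℂ} (hw : w ≠ 0) (hre : (w * c').re = (w * c).re)
    (him : (w * c').im = κ * (w * c).im) : c' = refract κ w c := by
  rw [refract_apply, eq_inv_mul_iff_mul_eq₀ hw, ← hre, ← him]

/-- The coefficient of `U q` in the derivative of index `q'` that belongs to the symbol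
`refract κ w (lead K U)`. -/
def refractCoeff (κ : ℝ) (w : ℂ) (q' q : ℕ × ℕ) : ℝ :=
  (Complex.I ^ q'.1 * refract κ w ((-Complex.I) ^ q.1)).re

theorem refractCoeff_one_zero (κ : ℝ) : refractCoeff κ 1 (0, 0) (0, 0) = 1 := by
  simp [refractCoeff, refract_apply]

theorem re_refract_lead (κ : ℝ) (w : ℂ) {K L : ℕ} (h : K ≤ L) (q' : ℕ × ℕ) (U : ℕ × ℕ → ℝ) :
    (Complex.I ^ q'.1 * refract κ w (lead K U)).re
      = ∑ q ∈ LamV1 L with q.1 + q.2 = K, refractCoeff κ w q' q * U q := by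
  simp only [lead_eq_sum h, map_sum, map_smul, Finset.mul_sum, Complex.re_sum, refractCoeff,
    mul_smul_comm, Complex.smul_re, smul_eq_mul, mul_comm (U _)]

/-! ### The transmission relations -/

/-- The functions whose derivatives at the base point enter the transmission relations. -/
inductive Datum
  /-- the solution on the positive side -/
  | uPlus
  /-- the solution on the negative side -/
  | uMinus
  /-- the source on the positive side -/
  | fPlus
  /-- the source on the negative side -/
  | fMinus
  /-- the jump of the solution -/
  | gD
  /-- the jump of the flux along the normal `(s', -r') / √(r'² + s'²)` -/
  | gN
  deriving DecidableEq

instance : Fintype Datum :=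
  ⟨{.uPlus, .uMinus, .fPlus, .fMinus, .gD, .gN}, fun d => by cases d <;> simp⟩

/-- The derivatives at the base point of all data. -/
abbrev JetSpace : Type := Datum → ℕ × ℕ → ℝ

/-- The vanishing of the source and of both jumps. -/
structure IsSourceFree (M : ℕ) (x : JetSpace) : Prop where
  fPlus : ∀ q ∈ Lam (M - 1), x .fPlus q = 0
  fMinus : ∀ q ∈ Lam (M - 1), x .fMinus q = 0
  gD : ∀ q ∈ Lam (M + 1), x .gD q = 0
  gN : ∀ q ∈ Lam M, x .gN q = 0

namespace Jet

open Datum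

variable {M : ℕ} (J : Jet M)

/-- The derivatives of `r`, continued by zero. -/
def rJet : ℕ → ℝ := Function.extend Fin.val J.r 0

/-- The derivatives of `s`, continued by zero. -/
def sJet : ℕ → ℝ := Function.extend Fin.val J.s 0

/-- The derivatives of the coefficient on the positive side, continued by zero. -/
def aPlusJet : ℕ × ℕ → ℝ := Function.extend Subtype.val J.aPlus 0

/-- The derivatives of the coefficient on the negative side, continued by zero. -/
def aMinusJet : ℕ × ℕ → ℝ := Function.extend Subtype.val J.aMinus 0

/-- The derivatives of `√(r'² + s'²)`. -/
def speedJet : ℕ → ℝ :=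
  sqrtJet (leibniz (shift J.rJet) (shift J.rJet) + leibniz (shift J.sJet) (shift J.sJet))

/-- The ratio of the coefficients on the two sides. -/
def contrast : ℝ := J.aPlus (origin M) / J.aMinus (origin M)

theorem rJet_apply {k : ℕ} (hk : k < M + 2) : J.rJet k = J.r ⟨k, hk⟩ :=
  Fin.val_injective.extend_apply _ _ ⟨k, hk⟩

theorem sJet_apply {k : ℕ} (hk : k < M + 2) : J.sJet k = J.s ⟨k, hk⟩ :=
  Fin.val_injective.extend_apply _ _ ⟨k, hk⟩

theorem aPlusJet_apply {q : ℕ × ℕ} (hq : q ∈ Lam M) : J.aPlusJet q = J.aPlus ⟨q, hq⟩ :=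
  Subtype.val_injective.extend_apply _ _ ⟨q, hq⟩

theorem aMinusJet_apply {q : ℕ × ℕ} (hq : q ∈ Lam M) : J.aMinusJet q = J.aMinus ⟨q, hq⟩ :=
  Subtype.val_injective.extend_apply _ _ ⟨q, hq⟩

/-- The nondegeneracy of the curve and of the coefficient. -/
structure Regular : Prop where
  tangent_ne_zero : tangent J.rJet J.sJet ≠ 0
  aPlus_ne_zero : J.aPlusJet (0, 0) ≠ 0
  aMinus_ne_zero : J.aMinusJet (0, 0) ≠ 0

/-- The relations between the derivatives at the base point that result from the differential
equation and from the two jump conditions, differentiated along the curve. The second jump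
condition is multiplied by the speed of the curve. -/
structure Transmits (x : JetSpace) : Prop where
  pde_plus : ∀ q : ℕ × ℕ, q.1 + q.2 + 1 ≤ M → ellipticJet J.aPlusJet (x uPlus) q = -x fPlus q
  pde_minus : ∀ q : ℕ × ℕ, q.1 + q.2 + 1 ≤ M → ellipticJet J.aMinusJet (x uMinus) q = -x fMinus q
  jump_u : ∀ k ≤ M + 1, traceJet J.rJet J.sJet (x uPlus) k
    = traceJet J.rJet J.sJet (x uMinus) k + traceJet J.rJet J.sJet (x gD) k
  jump_flux : ∀ k ≤ M, fluxJet J.rJet J.sJet J.aPlusJet (x uPlus) k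
    = fluxJet J.rJet J.sJet J.aMinusJet (x uMinus) k
      + leibniz J.speedJet (traceJet J.rJet J.sJet (x gN)) k

/-- The solutions of the transmission relations. -/
def transmissionSpace : Submodule ℝ JetSpace where
  carrier := {x | J.Transmits x}
  zero_mem' := by constructor <;> simp
  add_mem' {x y} hx hy := by
    constructor <;> intro k hk <;> simp only [Pi.add_apply, map_add]
    · rw [hx.pde_plus k hk, hy.pde_plus k hk, neg_add]
    · rw [hx.pde_minus k hk, hy.pde_minus k hk, neg_add]
    · rw [hx.jump_u k hk, hy.jump_u k hk, add_add_add_comm]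
    · rw [hx.jump_flux k hk, hy.jump_flux k hk, add_add_add_comm]
  smul_mem' c x hx := by
    constructor <;> intro k hk <;> simp only [Pi.smul_apply, map_smul]
    · rw [hx.pde_plus k hk, smul_neg]
    · rw [hx.pde_minus k hk, smul_neg]
    · rw [hx.jump_u k hk, smul_add]
    · rw [hx.jump_flux k hk, smul_add]

variable {J} {x : JetSpace}

/-- At the first order at which the solution of the homogeneous relations does not vanish, its
symbol is refracted like a plane wave: the tangential derivatives agree and the normal ones are
inversely proportional to the coefficients. -/
theorem Transmits.hasSymbol (hJ : J.Regular) (hx : J.Transmits x) (hsrc : IsSourceFree M x) {k : ℕ}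
    (hk : k ≤ M + 1) (hU : IsFlatBelow k (x uPlus)) (hV : IsFlatBelow k (x uMinus)) :
    HasSymbol k (x uPlus) (lead k (x uPlus)) ∧
      HasSymbol k (x uMinus)
        (refract J.contrast (tangent J.rJet J.sJet ^ k) (lead k (x uPlus))) := by
  have hsymU : HasSymbol k (x uPlus) (lead k (x uPlus)) :=
    hasSymbol_of_ellipticJet hJ.aPlus_ne_zero hU fun q hq => by
      rw [hx.pde_plus q (by omega), hsrc.fPlus q (mem_Lam.2 (by omega)), neg_zero]
  have hsymV : HasSymbol k (x uMinus) (lead k (x uMinus)) :=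
    hasSymbol_of_ellipticJet hJ.aMinus_ne_zero hV fun q hq => by
      rw [hx.pde_minus q (by omega), hsrc.fMinus q (mem_Lam.2 (by omega)), neg_zero]
  refine ⟨hsymU, ?_⟩
  rw [← eq_refract (pow_ne_zero k hJ.tangent_ne_zero) _ _]
  · exact hsymV
  · rw [← hsymU.traceJet_eq hU, ← hsymV.traceJet_eq hV, hx.jump_u k hk,
      traceJet_eq_zero (G := x gD) fun q hq => hsrc.gD q (mem_Lam.2 (by omega)), add_zero]
  · cases k with
    | zero => simp [lead_zero]
    | succ k =>
      have hflux := hx.jump_flux k (by omega)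
      rw [hsymU.fluxJet_eq hU, hsymV.fluxJet_eq hV, leibniz_eq_zero fun j hj =>
        traceJet_eq_zero fun q hq => hsrc.gN q (mem_Lam.2 (by omega)), add_zero] at hflux
      have hcontrast : J.contrast = J.aPlusJet (0, 0) / J.aMinusJet (0, 0) := by
        rw [aPlusJet_apply _ (mem_Lam.2 (Nat.zero_le M)),
          aMinusJet_apply _ (mem_Lam.2 (Nat.zero_le M))]
        rfl
      rw [hcontrast, div_mul_eq_mul_div, eq_div_iff hJ.aMinus_ne_zero]
      linarith

theorem Transmits.isFlatBelow (hJ : J.Regular) (hx : J.Transmits x) (hsrc : IsSourceFree M x)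
    {K : ℕ} (hK : K ≤ M + 1) (hU : ∀ q ∈ LamV1 (M + 1), 0 < q.1 + q.2 → q.1 + q.2 < K →
      x uPlus q = 0) : IsFlatBelow K (x uPlus) ∧ IsFlatBelow K (x uMinus) := by
  induction K with
  | zero => exact ⟨fun _ _ h => absurd h (Nat.not_lt_zero _), fun _ _ h =>
      absurd h (Nat.not_lt_zero _)⟩
  | succ k ih =>
    obtain ⟨hflatU, hflatV⟩ := ih (by omega) fun q hq h0 hlt => hU q hq h0 (by omega)
    obtain ⟨hsymU, hsymV⟩ := hx.hasSymbol hJ hsrc (by omega) hflatU hflatV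
    have hlead (hk : 0 < k) : lead k (x uPlus) = 0 := by
      rw [lead_eq_sum (by omega : k ≤ M + 1)]
      refine Finset.sum_eq_zero fun q hq => ?_
      obtain ⟨hq, hqk⟩ := Finset.mem_filter.1 hq
      rw [hU q hq (by omega) (by omega), zero_smul]
    refine ⟨hflatU.succ fun hk => ?_, hflatV.succ fun hk => ?_⟩
    · rwa [hlead hk] at hsymU
    · rwa [hlead hk, map_zero] at hsymV

variable (J) in
/-- The coefficient in `u_-^(q')` of the derivative `u_+^(q)` of the same order. -/
def topCoeff (q' q : ℕ × ℕ) : ℝ :=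
  refractCoeff J.contrast (tangent J.rJet J.sJet ^ (q'.1 + q'.2)) q' q

theorem topCoeff_zero (J : Jet M) : J.topCoeff (0, 0) (0, 0) = 1 := by
  simp [topCoeff, refractCoeff_one_zero]

theorem topCoeff_congr {J J' : Jet M} (hr : J.r = J'.r) (hs : J.s = J'.s)
    (hp : J.aPlus (origin M) = J'.aPlus (origin M))
    (hm : J.aMinus (origin M) = J'.aMinus (origin M)) : J.topCoeff = J'.topCoeff := by
  unfold topCoeff contrast rJet sJet
  rw [hr, hs, hp, hm]

theorem Transmits.uMinus_eq_sum (hJ : J.Regular) (hx : J.Transmits x) (hsrc : IsSourceFree M x)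
    {q' : ℕ × ℕ} (hq' : q'.1 + q'.2 ≤ M + 1) (hU : ∀ q ∈ LamV1 (M + 1), 0 < q.1 + q.2 →
      q.1 + q.2 < q'.1 + q'.2 → x uPlus q = 0) :
    x uMinus q'
      = ∑ q ∈ LamV1 (M + 1) with q.1 + q.2 = q'.1 + q'.2, J.topCoeff q' q * x uPlus q := by
  obtain ⟨hflatU, hflatV⟩ := hx.isFlatBelow hJ hsrc hq' hU
  rw [(hx.hasSymbol hJ hsrc hq' hflatU hflatV).2 q' rfl, re_refract_lead _ _ hq']
  rfl

end Jet

theorem exists_eq_sum_on_submodule {𝕜 V ι : Type*} [Field 𝕜] [AddCommGroup V] [Module 𝕜 V]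
    (W : Submodule 𝕜 V) (T : Finset ι) (L : ι → Module.Dual 𝕜 V) (φ : Module.Dual 𝕜 V)
    (h : ∀ x ∈ W, (∀ i ∈ T, L i x = 0) → φ x = 0) :
    ∃ c : ι → 𝕜, ∀ x ∈ W, φ x = ∑ i ∈ T, c i * L i x := by
  have hspan : φ.domRestrict W ∈
      Submodule.span 𝕜 ((fun i => (L i).domRestrict W) '' (T : Set ι)) := by
    rw [Set.image_eq_range]
    refine mem_span_of_iInf_ker_le_ker fun x hx => ?_
    simp only [Submodule.mem_iInf, LinearMap.mem_ker, LinearMap.domRestrict_apply] at hx ⊢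
    exact h x x.2 fun i hi => hx ⟨i, hi⟩
  rw [Submodule.mem_span_image_finset_iff_exists_fun'] at hspan
  obtain ⟨c, hc⟩ := hspan
  refine ⟨c, fun x hx => ?_⟩
  simpa using (LinearMap.congr_fun hc ⟨x, hx⟩).symm

theorem Datum.sum_eq (F : Datum → ℝ) :
    ∑ d, F d = F .uPlus + F .uMinus + F .fPlus + F .fMinus + F .gD + F .gN := by
  rw [show (Finset.univ : Finset Datum) = {.uPlus, .uMinus, .fPlus, .fMinus, .gD, .gN} from rfl]
  simp [add_assoc]

namespace Jet

open Datum

variable {M : ℕ}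

/-- The derivatives that determine those of order `K` of `u_-`, apart from the ones of order `K` of
`u_+`. -/
def known (M K : ℕ) : Datum → Finset (ℕ × ℕ)
  | uPlus => {q ∈ LamV1 (M + 1) | 0 < q.1 + q.2 ∧ q.1 + q.2 < K}
  | uMinus => ∅
  | fPlus | fMinus => Lam (M - 1)
  | gD => Lam (M + 1)
  | gN => Lam M

theorem exists_coeffs_lower {J : Jet M} (hJ : J.Regular) {q' : ℕ × ℕ} (hq' : q'.1 + q'.2 ≤ M + 1) :
    ∃ c : Datum → ℕ × ℕ → ℝ, ∀ x, J.Transmits x →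
      x uMinus q' - ∑ q ∈ LamV1 (M + 1) with q.1 + q.2 = q'.1 + q'.2,
        J.topCoeff q' q * x uPlus q
      = ∑ d, ∑ q ∈ known M (q'.1 + q'.2) d, c d q * x d q := by
  let eval (d : Datum) (q : ℕ × ℕ) : Module.Dual ℝ JetSpace := LinearMap.proj q ∘ₗ LinearMap.proj d
  let φ : Module.Dual ℝ JetSpace := eval uMinus q'
    - ∑ q ∈ LamV1 (M + 1) with q.1 + q.2 = q'.1 + q'.2, J.topCoeff q' q • eval uPlus q
  have hφ (x : JetSpace) : φ x = x uMinus q'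
      - ∑ q ∈ LamV1 (M + 1) with q.1 + q.2 = q'.1 + q'.2, J.topCoeff q' q * x uPlus q := by
    simp [φ, eval]
  obtain ⟨c, hc⟩ := exists_eq_sum_on_submodule J.transmissionSpace
    (Finset.univ.sigma (known M (q'.1 + q'.2))) (fun i => eval i.1 i.2) φ fun x hx h0 => by
      have hknown (d : Datum) (q) (hq : q ∈ known M (q'.1 + q'.2) d) : x d q = 0 :=
        h0 ⟨d, q⟩ (Finset.mem_sigma.2 ⟨Finset.mem_univ d, hq⟩)
      rw [hφ, sub_eq_zero]
      exact Transmits.uMinus_eq_sum hJ hx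
        ⟨hknown fPlus, hknown fMinus, hknown gD, hknown gN⟩ hq'
        fun q hq hpos hlt => hknown uPlus q (Finset.mem_filter.2 ⟨hq, hpos, hlt⟩)
  refine ⟨fun d q => c ⟨d, q⟩, fun x hx => ?_⟩
  rw [← hφ, hc x hx, Finset.sum_sigma]
  rfl

theorem exists_coeffs (J : Jet M) (q' : ℕ × ℕ) :
    ∃ c : Datum → ℕ × ℕ → ℝ,
      (J.Regular → q' ∈ LamV1 (M + 1) → ∀ x, J.Transmits x →
        x uMinus q' = (∑ q ∈ LamV1 (M + 1) with q.1 + q.2 ≤ q'.1 + q'.2, c uPlus q * x uPlus q)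
          + (∑ q ∈ Lam (M - 1), (c fPlus q * x fPlus q + c fMinus q * x fMinus q))
          + (∑ q ∈ Lam (M + 1), c gD q * x gD q) + ∑ q ∈ Lam M, c gN q * x gN q) ∧
      (∀ q : ℕ × ℕ, q.1 + q.2 = q'.1 + q'.2 → c uPlus q = J.topCoeff q' q) ∧
      (q' ≠ (0, 0) → c uPlus (0, 0) = 0) := by
  obtain ⟨c, hc⟩ : ∃ c : Datum → ℕ × ℕ → ℝ, J.Regular → q' ∈ LamV1 (M + 1) → ∀ x, J.Transmits x →
      x uMinus q' - ∑ q ∈ LamV1 (M + 1) with q.1 + q.2 = q'.1 + q'.2,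
        J.topCoeff q' q * x uPlus q
      = ∑ d, ∑ q ∈ known M (q'.1 + q'.2) d, c d q * x d q := by
    by_cases h : J.Regular ∧ q' ∈ LamV1 (M + 1)
    · obtain ⟨c, hc⟩ := exists_coeffs_lower h.1 (mem_LamV1.1 h.2).1
      exact ⟨c, fun _ _ => hc⟩
    · exact ⟨0, fun hJ hq' => absurd ⟨hJ, hq'⟩ h⟩
  let cPlus (q : ℕ × ℕ) : ℝ := if q.1 + q.2 = q'.1 + q'.2 then J.topCoeff q' q
    else if 0 < q.1 + q.2 then c uPlus q else 0
  refine ⟨Function.update c uPlus cPlus, fun hJ hq' x hx => ?_, fun q hq => ?_, fun hq' => ?_⟩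
  · have hsplit : ∑ q ∈ LamV1 (M + 1) with q.1 + q.2 ≤ q'.1 + q'.2, cPlus q * x uPlus q
        = ∑ q ∈ LamV1 (M + 1) with q.1 + q.2 = q'.1 + q'.2, J.topCoeff q' q * x uPlus q
          + ∑ q ∈ known M (q'.1 + q'.2) uPlus, c uPlus q * x uPlus q := by
      simp only [known, Finset.sum_filter, ← Finset.sum_add_distrib, cPlus]
      refine Finset.sum_congr rfl fun q _ => ?_
      split_ifs <;> first | omega | simp
    have hlower := hc hJ hq' x hx
    rw [Datum.sum_eq] at hlower
    simp only [Function.update_self, Function.update_of_ne, ne_eq, reduceCtorEq, not_false_eq_true,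
      hsplit, Finset.sum_add_distrib]
    simp only [known, Finset.sum_empty] at hlower ⊢
    linarith
  · rw [Function.update_self]
    exact if_pos hq
  · have hpos : (0 : ℕ) ≠ q'.1 + q'.2 := fun h => hq' (Prod.ext (by dsimp only; omega)
      (by dsimp only; omega))
    simp [cPlus, hpos]

end Jet

/-! ### Directional and partial derivatives -/

section DirDeriv

variable {E : Type*} [NormedAddCommGroup E] [NormedSpace ℝ E] {F G : E → ℝ} {p v w : E}
  {k n : ℕ}

/-- The derivative in the direction `v`, as an operator that can be iterated. -/
def dirDeriv (v : E) (F : E → ℝ) : E → ℝ := fun p => lineDeriv ℝ F p v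

theorem dirDeriv_congr (h : F =ᶠ[𝓝 p] G) : dirDeriv v F =ᶠ[𝓝 p] dirDeriv v G :=
  h.eventuallyEq_nhds.mono fun _ hq => hq.lineDeriv_eq

theorem iterate_dirDeriv_congr (h : F =ᶠ[𝓝 p] G) (n : ℕ) :
    (dirDeriv v)^[n] F =ᶠ[𝓝 p] (dirDeriv v)^[n] G := by
  induction n with
  | zero => exact h
  | succ n ih => simpa only [Function.iterate_succ_apply'] using dirDeriv_congr ih

theorem dirDeriv_eventuallyEq (h : ContDiffAt ℝ (n + 1 : ℕ) F p) (v : E) :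
    dirDeriv v F =ᶠ[𝓝 p] fun q => fderiv ℝ F q v :=
  (h.eventually (by simp)).mono fun _ hq => (hq.differentiableAt (by simp)).lineDeriv_eq_fderiv

theorem contDiffAt_dirDeriv (h : ContDiffAt ℝ (n + 1 : ℕ) F p) (v : E) :
    ContDiffAt ℝ n (dirDeriv v F) p :=
  ((h.fderiv_right (by norm_cast)).clm_apply contDiffAt_const).congr_of_eventuallyEq
    (dirDeriv_eventuallyEq h v)

theorem contDiffAt_iterate_dirDeriv (h : ContDiffAt ℝ (n + k : ℕ) F p) (v : E) :
    ContDiffAt ℝ n ((dirDeriv v)^[k] F) p := by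
  induction k generalizing n with
  | zero => exact h
  | succ k ih =>
    rw [Function.iterate_succ_apply']
    exact contDiffAt_dirDeriv (ih (by rwa [add_right_comm, add_assoc])) v

theorem dirDeriv_dirDeriv_eq (h : ContDiffAt ℝ 2 F p) (v w : E) :
    dirDeriv v (dirDeriv w F) p = fderiv ℝ (fderiv ℝ F) p v w := by
  have hd : DifferentiableAt ℝ (fderiv ℝ F) p :=
    (h.fderiv_right (m := 1) (by norm_num)).differentiableAt one_ne_zero
  rw [(dirDeriv_congr (dirDeriv_eventuallyEq (n := 1) h w)).eq_of_nhds]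
  have hw := hd.hasFDerivAt.clm_apply (hasFDerivAt_const w p)
  rw [dirDeriv, hw.differentiableAt.lineDeriv_eq_fderiv, hw.fderiv]
  simp

theorem dirDeriv_comm (h : ContDiffAt ℝ 2 F p) (v w : E) :
    dirDeriv v (dirDeriv w F) =ᶠ[𝓝 p] dirDeriv w (dirDeriv v F) :=
  (h.eventually (by simp)).mono fun q hq => by
    rw [dirDeriv_dirDeriv_eq hq, dirDeriv_dirDeriv_eq hq]
    exact hq.isSymmSndFDerivAt (by simp) v w

theorem dirDeriv_iterate_comm (h : ContDiffAt ℝ (n + 1 : ℕ) F p) (v w : E) :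
    dirDeriv v ((dirDeriv w)^[n] F) =ᶠ[𝓝 p] (dirDeriv w)^[n] (dirDeriv v F) := by
  induction n generalizing F with
  | zero => rfl
  | succ n ih =>
    rw [Function.iterate_succ_apply, Function.iterate_succ_apply]
    refine (ih (contDiffAt_dirDeriv h w)).trans (iterate_dirDeriv_congr (dirDeriv_comm ?_ v w) n)
    exact h.of_le (by norm_cast; omega)

theorem iterate_dirDeriv_eq_iteratedDeriv (v : E) (F : E → ℝ) (n : ℕ) (p : E) :
    (dirDeriv v)^[n] F p = iteratedDeriv n (fun t : ℝ => F (p + t • v)) 0 := by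
  induction n generalizing p with
  | zero => simp
  | succ n ih =>
    rw [Function.iterate_succ_apply', dirDeriv, lineDeriv, iteratedDeriv_succ]
    congr 1 with t
    have hshift := congrFun (iteratedDeriv_comp_const_add n (fun t : ℝ => F (p + t • v)) t) 0
    rw [add_zero] at hshift
    simp only [ih, ← hshift, add_smul, add_assoc]

theorem contDiffAt_line (h : ContDiffAt ℝ n F p) (v : E) :
    ContDiffAt ℝ n (fun t : ℝ => F (p + t • v)) 0 :=
  ContDiffAt.comp 0 (by simpa using h) (by fun_prop)

theorem iterate_dirDeriv_add (hF : ContDiffAt ℝ n F p) (hG : ContDiffAt ℝ n G p) :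
    (dirDeriv v)^[n] (fun z => F z + G z) p = (dirDeriv v)^[n] F p + (dirDeriv v)^[n] G p := by
  simp only [iterate_dirDeriv_eq_iteratedDeriv]
  exact iteratedDeriv_fun_add (contDiffAt_line hF v) (contDiffAt_line hG v)

theorem iterate_dirDeriv_neg (v : E) (F : E → ℝ) (n : ℕ) :
    (dirDeriv v)^[n] (fun z => -F z) = fun z => -(dirDeriv v)^[n] F z := by
  ext p
  simp only [iterate_dirDeriv_eq_iteratedDeriv, iteratedDeriv_fun_neg]

theorem iterate_dirDeriv_mul (hF : ContDiffAt ℝ n F p) (hG : ContDiffAt ℝ n G p) :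
    (dirDeriv v)^[n] (fun z => F z * G z) p
      = leibniz (fun i => (dirDeriv v)^[i] F p) (fun i => (dirDeriv v)^[i] G p) n := by
  simp only [iterate_dirDeriv_eq_iteratedDeriv, leibniz_apply]
  exact iteratedDeriv_fun_mul (contDiffAt_line hF v) (contDiffAt_line hG v)

theorem iterate_dirDeriv_sum_mul {ι : Type*} {s : Finset ι} {c : ι → ℝ} {F : ι → E → ℝ}
    (hF : ∀ j ∈ s, ContDiffAt ℝ n (F j) p) :
    (dirDeriv v)^[n] (fun z => ∑ j ∈ s, c j * F j z) p
      = ∑ j ∈ s, c j * (dirDeriv v)^[n] (F j) p := by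
  simp only [iterate_dirDeriv_eq_iteratedDeriv]
  rw [iteratedDeriv_fun_sum fun j hj => contDiffAt_const.mul (contDiffAt_line (hF j hj) v)]
  simp only [iteratedDeriv_const_mul_field]

end DirDeriv

variable {F G : ℝ × ℝ → ℝ} {p : ℝ × ℝ}

theorem partialX_eq_dirDeriv : partialX = dirDeriv (1, 0) := by
  ext F p
  simp [partialX, dirDeriv, lineDeriv, deriv_comp_const_add (f := fun x => F (x, p.2)),
    Prod.add_def]

theorem partialY_eq_dirDeriv : partialY = dirDeriv (0, 1) := by
  ext F p
  simp [partialY, dirDeriv, lineDeriv, deriv_comp_const_add (f := fun y => F (p.1, y)),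
    Prod.add_def]

theorem pderiv_eq_dirDeriv (q : ℕ × ℕ) (F : ℝ × ℝ → ℝ) :
    pderiv q F = (dirDeriv (1, 0))^[q.1] ((dirDeriv (0, 1))^[q.2] F) := by
  rw [pderiv, partialX_eq_dirDeriv, partialY_eq_dirDeriv]

theorem pderiv_congr (h : F =ᶠ[𝓝 p] G) (q : ℕ × ℕ) : pderiv q F =ᶠ[𝓝 p] pderiv q G := by
  simpa only [pderiv_eq_dirDeriv] using iterate_dirDeriv_congr (iterate_dirDeriv_congr h q.2) q.1

theorem contDiffAt_pderiv {n K : ℕ} (h : ContDiffAt ℝ K F p) {q : ℕ × ℕ}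
    (hn : n + (q.1 + q.2) ≤ K) : ContDiffAt ℝ n (pderiv q F) p := by
  rw [pderiv_eq_dirDeriv]
  refine contDiffAt_iterate_dirDeriv (contDiffAt_iterate_dirDeriv (h.of_le ?_) _) _
  rw [add_assoc]
  exact_mod_cast hn

theorem partialX_pderiv (q : ℕ × ℕ) (F : ℝ × ℝ → ℝ) :
    partialX (pderiv q F) = pderiv (q.1 + 1, q.2) F :=
  (Function.iterate_succ_apply' partialX q.1 _).symm

theorem pderiv_partialY (q : ℕ × ℕ) (F : ℝ × ℝ → ℝ) :
    pderiv q (partialY F) = pderiv (q.1, q.2 + 1) F := rfl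

theorem partialY_pderiv {q : ℕ × ℕ} (h : ContDiffAt ℝ (q.1 + q.2 + 1 : ℕ) F p) :
    partialY (pderiv q F) =ᶠ[𝓝 p] pderiv (q.1, q.2 + 1) F := by
  rw [pderiv_eq_dirDeriv, pderiv_eq_dirDeriv, partialY_eq_dirDeriv, Function.iterate_succ_apply']
  exact dirDeriv_iterate_comm (contDiffAt_iterate_dirDeriv (by rwa [add_right_comm]) _) _ _

theorem pderiv_partialX {q : ℕ × ℕ} (h : ContDiffAt ℝ (q.1 + q.2 + 1 : ℕ) F p) :
    pderiv q (partialX F) =ᶠ[𝓝 p] pderiv (q.1 + 1, q.2) F := by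
  rw [pderiv_eq_dirDeriv, pderiv_eq_dirDeriv, partialX_eq_dirDeriv, Function.iterate_succ_apply]
  exact iterate_dirDeriv_congr
    (dirDeriv_iterate_comm (h.of_le (by norm_cast; omega)) _ _).symm _

theorem pderiv_neg (q : ℕ × ℕ) (F : ℝ × ℝ → ℝ) :
    pderiv q (fun z => -F z) = fun z => -pderiv q F z := by
  simp only [pderiv_eq_dirDeriv, iterate_dirDeriv_neg]

theorem pderiv_add {q : ℕ × ℕ} (hF : ContDiffAt ℝ (q.1 + q.2 : ℕ) F p)
    (hG : ContDiffAt ℝ (q.1 + q.2 : ℕ) G p) :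
    pderiv q (fun z => F z + G z) p = pderiv q F p + pderiv q G p := by
  have hY : (dirDeriv (0, 1))^[q.2] (fun z => F z + G z)
      =ᶠ[𝓝 p] fun z => (dirDeriv (0, 1))^[q.2] F z + (dirDeriv (0, 1))^[q.2] G z := by
    filter_upwards [hF.eventually (by exact_mod_cast ENat.natCast_ne_top _),
      hG.eventually (by exact_mod_cast ENat.natCast_ne_top _)] with z hFz hGz
    exact iterate_dirDeriv_add (hFz.of_le (by norm_cast; omega)) (hGz.of_le (by norm_cast; omega))
  simp only [pderiv_eq_dirDeriv]
  rw [(iterate_dirDeriv_congr hY q.1).eq_of_nhds, iterate_dirDeriv_add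
    (contDiffAt_iterate_dirDeriv hF _) (contDiffAt_iterate_dirDeriv hG _)]

theorem pderiv_mul {q : ℕ × ℕ} (hF : ContDiffAt ℝ (q.1 + q.2 : ℕ) F p)
    (hG : ContDiffAt ℝ (q.1 + q.2 : ℕ) G p) :
    pderiv q (fun z => F z * G z) p
      = leibniz₂ (fun q => pderiv q F p) (fun q => pderiv q G p) q := by
  have hY : (dirDeriv (0, 1))^[q.2] (fun z => F z * G z) =ᶠ[𝓝 p] fun z =>
      ∑ j ∈ Finset.range (q.2 + 1), (q.2.choose j : ℝ) *
        ((dirDeriv (0, 1))^[j] F z * (dirDeriv (0, 1))^[q.2 - j] G z) := by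
    filter_upwards [hF.eventually (by exact_mod_cast ENat.natCast_ne_top _),
      hG.eventually (by exact_mod_cast ENat.natCast_ne_top _)] with z hFz hGz
    rw [iterate_dirDeriv_mul (hFz.of_le (by norm_cast; omega)) (hGz.of_le (by norm_cast; omega)),
      leibniz_apply]
    simp only [mul_assoc]
  have hFj (j) (hj : j ≤ q.2) : ContDiffAt ℝ q.1 ((dirDeriv (0, 1))^[j] F) p :=
    contDiffAt_iterate_dirDeriv (hF.of_le (by norm_cast; omega)) _
  have hGj (j) (hj : j ≤ q.2) : ContDiffAt ℝ q.1 ((dirDeriv (0, 1))^[j] G) p :=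
    contDiffAt_iterate_dirDeriv (hG.of_le (by norm_cast; omega)) _
  simp only [pderiv_eq_dirDeriv, leibniz₂_apply]
  rw [(iterate_dirDeriv_congr hY q.1).eq_of_nhds, iterate_dirDeriv_sum_mul, Finset.sum_comm]
  · refine Finset.sum_congr rfl fun j hj => ?_
    rw [iterate_dirDeriv_mul (hFj j (Finset.mem_range_succ_iff.1 hj)) (hGj _ (Nat.sub_le _ _)),
      leibniz_apply, Finset.mul_sum]
    refine Finset.sum_congr rfl fun i _ => ?_
    ring
  · exact fun j hj => (hFj j (Finset.mem_range_succ_iff.1 hj)).mul (hGj _ (Nat.sub_le _ _))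

theorem pderiv_divergence {a u : ℝ × ℝ → ℝ} {q : ℕ × ℕ}
    (ha : ContDiffAt ℝ (q.1 + q.2 + 1 : ℕ) a p) (hu : ContDiffAt ℝ (q.1 + q.2 + 2 : ℕ) u p) :
    pderiv q (fun z => partialX (fun z => a z * partialX u z) z
      + partialY (fun z => a z * partialY u z) z) p
      = ellipticJet (fun q => pderiv q a p) (fun q => pderiv q u p) q := by
  have hux : ContDiffAt ℝ (q.1 + q.2 + 1 : ℕ) (partialX u) p :=
    contDiffAt_pderiv hu (q := (1, 0)) (by omega)
  have huy : ContDiffAt ℝ (q.1 + q.2 + 1 : ℕ) (partialY u) p :=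
    contDiffAt_pderiv hu (q := (0, 1)) (by omega)
  have hX : ContDiffAt ℝ (q.1 + q.2 : ℕ) (partialX fun z => a z * partialX u z) p :=
    contDiffAt_pderiv (ha.mul hux) (q := (1, 0)) le_rfl
  have hY : ContDiffAt ℝ (q.1 + q.2 : ℕ) (partialY fun z => a z * partialY u z) p :=
    contDiffAt_pderiv (ha.mul huy) (q := (0, 1)) (by omega)
  rw [pderiv_add hX hY, (pderiv_partialX (ha.mul hux)).eq_of_nhds, pderiv_partialY,
    pderiv_mul (q := (q.1 + 1, q.2)) (ha.of_le (by norm_cast; omega))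
      (hux.of_le (by norm_cast; omega)), pderiv_mul (q := (q.1, q.2 + 1)) ha huy, ellipticJet_apply]
  congr 1
  refine leibniz₂_congr fun q' hq' => (pderiv_partialX (hu.of_le ?_)).eq_of_nhds
  norm_cast
  omega

theorem hasDerivAt_comp_curve {c : ℝ → ℝ × ℝ} {v : ℝ × ℝ} {t : ℝ}
    (h : DifferentiableAt ℝ F (c t)) (hc : HasDerivAt c v t) :
    HasDerivAt (fun t => F (c t)) (v.1 * partialX F (c t) + v.2 * partialY F (c t)) t := by
  have hv : v = v.1 • ((1 : ℝ), (0 : ℝ)) + v.2 • ((0 : ℝ), (1 : ℝ)) := by ext <;> simp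
  rw [partialX_eq_dirDeriv, partialY_eq_dirDeriv, dirDeriv, dirDeriv, h.lineDeriv_eq_fderiv,
    h.lineDeriv_eq_fderiv, ← smul_eq_mul, ← smul_eq_mul, ← map_smul, ← map_smul, ← map_add, ← hv]
  exact h.hasFDerivAt.comp_hasDerivAt t hc

/-! ### Derivatives along a curve -/

/-- The function `f` is `K` times continuously differentiable at `t`, and `x` lists its derivatives
there up to order `K`. -/
structure HasJetAt (K : ℕ) (f : ℝ → ℝ) (t : ℝ) (x : ℕ → ℝ) : Prop where
  contDiffAt : ContDiffAt ℝ K f t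
  iteratedDeriv_eq : ∀ k ≤ K, iteratedDeriv k f t = x k

namespace HasJetAt

variable {K L : ℕ} {f g : ℝ → ℝ} {t : ℝ} {x y : ℕ → ℝ}

theorem congr (h : HasJetAt K f t x) (hfg : f =ᶠ[𝓝 t] g) : HasJetAt K g t x :=
  ⟨h.contDiffAt.congr_of_eventuallyEq hfg.symm, fun k hk =>
    (hfg.iteratedDeriv_eq k).symm.trans (h.iteratedDeriv_eq k hk)⟩

theorem unique (hf : HasJetAt K f t x) (hg : HasJetAt K g t y) (hfg : f =ᶠ[𝓝 t] g) {k : ℕ}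
    (hk : k ≤ K) : x k = y k :=
  (hf.iteratedDeriv_eq k hk).symm.trans ((hg.congr hfg.symm).iteratedDeriv_eq k hk)

theorem of_le (h : HasJetAt K f t x) (hL : L ≤ K) : HasJetAt L f t x :=
  ⟨h.contDiffAt.of_le (mod_cast hL), fun k hk => h.iteratedDeriv_eq k (hk.trans hL)⟩

theorem const_mul (h : HasJetAt K f t x) (c : ℝ) : HasJetAt K (fun τ => c * f τ) t (c • x) :=
  ⟨contDiffAt_const.mul h.contDiffAt, fun k hk => by
    rw [iteratedDeriv_const_mul_field, h.iteratedDeriv_eq k hk, Pi.smul_apply, smul_eq_mul]⟩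

theorem apply_zero (h : HasJetAt K f t x) : x 0 = f t := by
  rw [← h.iteratedDeriv_eq 0 (Nat.zero_le K), iteratedDeriv_zero]

theorem of_hasDerivAt (hfg : ∀ᶠ τ in 𝓝 t, HasDerivAt f (g τ) τ) (hg : HasJetAt K g t (shift x))
    (h0 : f t = x 0) : HasJetAt (K + 1) f t x := by
  refine ⟨?_, fun k hk => ?_⟩
  · refine contDiffAt_succ_iff_hasFDerivAt.2
      ⟨fun τ => ContinuousLinearMap.toSpanSingleton ℝ (g τ), ⟨_, hfg, fun τ hτ => hτ⟩, ?_⟩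
    exact (ContinuousLinearMap.toSpanSingletonCLE (𝕜 := ℝ) (E := ℝ)).contDiff.contDiffAt.comp t
      hg.contDiffAt
  · cases k with
    | zero => rw [iteratedDeriv_zero, h0]
    | succ k =>
      have hderiv : deriv f =ᶠ[𝓝 t] g := hfg.mono fun τ hτ => hτ.deriv
      rw [iteratedDeriv_succ', hderiv.iteratedDeriv_eq, hg.iteratedDeriv_eq k (by omega),
        shift_apply]

protected theorem deriv (h : HasJetAt (K + 1) f t x) : HasJetAt K (deriv f) t (shift x) :=
  ⟨h.contDiffAt.derivWithin le_rfl, fun k hk => by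
    rw [← iteratedDeriv_succ', h.iteratedDeriv_eq _ (by omega), shift_apply]⟩

theorem add (hf : HasJetAt K f t x) (hg : HasJetAt K g t y) :
    HasJetAt K (fun τ => f τ + g τ) t (x + y) :=
  ⟨hf.contDiffAt.add hg.contDiffAt, fun k hk => by
    have hkK : (k : WithTop ℕ∞) ≤ K := mod_cast hk
    rw [iteratedDeriv_fun_add (hf.contDiffAt.of_le hkK) (hg.contDiffAt.of_le hkK),
      hf.iteratedDeriv_eq k hk, hg.iteratedDeriv_eq k hk, Pi.add_apply]⟩

theorem sub (hf : HasJetAt K f t x) (hg : HasJetAt K g t y) :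
    HasJetAt K (fun τ => f τ - g τ) t (x - y) :=
  ⟨hf.contDiffAt.sub hg.contDiffAt, fun k hk => by
    have hkK : (k : WithTop ℕ∞) ≤ K := mod_cast hk
    rw [iteratedDeriv_fun_sub (hf.contDiffAt.of_le hkK) (hg.contDiffAt.of_le hkK),
      hf.iteratedDeriv_eq k hk, hg.iteratedDeriv_eq k hk, Pi.sub_apply]⟩

theorem mul (hf : HasJetAt K f t x) (hg : HasJetAt K g t y) :
    HasJetAt K (fun τ => f τ * g τ) t (leibniz x y) :=
  ⟨hf.contDiffAt.mul hg.contDiffAt, fun k hk => by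
    have hkK : (k : WithTop ℕ∞) ≤ K := mod_cast hk
    rw [iteratedDeriv_fun_mul (hf.contDiffAt.of_le hkK) (hg.contDiffAt.of_le hkK), ← leibniz_apply
      (fun i => iteratedDeriv i f t) (fun i => iteratedDeriv i g t)]
    exact leibniz_congr (fun i hi => hf.iteratedDeriv_eq i (hi.trans hk))
      fun i hi => hg.iteratedDeriv_eq i (hi.trans hk)⟩

theorem sqrt (hf : HasJetAt K f t x) (h0 : 0 < f t) :
    HasJetAt K (fun τ => √(f τ)) t (sqrtJet x) := by
  have hroot : HasJetAt K (fun τ => √(f τ)) t fun k => iteratedDeriv k (fun τ => √(f τ)) t :=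
    ⟨hf.contDiffAt.sqrt h0.ne', fun _ _ => rfl⟩
  have hsq : (fun τ => √(f τ) * √(f τ)) =ᶠ[𝓝 t] f :=
    (hf.contDiffAt.continuousAt.eventually_const_lt h0).mono fun τ hτ => Real.mul_self_sqrt hτ.le
  refine ⟨hroot.contDiffAt, fun k hk => eq_sqrtJet (hf.apply_zero ▸ h0) ?_
    (fun j hj => (hroot.mul hroot).unique hf hsq hj) hk⟩
  rw [iteratedDeriv_zero, hf.apply_zero]

end HasJetAt

/-- The family `y` behaves, near the parameter `t₀`, like the family of all partial derivatives of
order at most `K` of a function along the curve `(r, s)`. -/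
structure IsCurveFamily (K : ℕ) (r s : ℝ → ℝ) (t₀ : ℝ) (y : ℕ × ℕ → ℝ → ℝ) : Prop where
  continuousAt : ∀ q : ℕ × ℕ, q.1 + q.2 ≤ K → ∀ᶠ t in 𝓝 t₀, ContinuousAt (y q) t
  hasDerivAt : ∀ q : ℕ × ℕ, q.1 + q.2 < K → ∀ᶠ t in 𝓝 t₀,
    HasDerivAt (y q) (deriv r t * y (q.1 + 1, q.2) t + deriv s t * y (q.1, q.2 + 1) t) t

namespace IsCurveFamily

variable {K : ℕ} {r s : ℝ → ℝ} {t₀ : ℝ} {y : ℕ × ℕ → ℝ → ℝ}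

theorem shiftX (hy : IsCurveFamily (K + 1) r s t₀ y) :
    IsCurveFamily K r s t₀ fun q => y (q.1 + 1, q.2) where
  continuousAt q hq := hy.continuousAt _ (by dsimp only; omega)
  hasDerivAt q hq := hy.hasDerivAt _ (by dsimp only; omega)

theorem shiftY (hy : IsCurveFamily (K + 1) r s t₀ y) :
    IsCurveFamily K r s t₀ fun q => y (q.1, q.2 + 1) where
  continuousAt q hq := hy.continuousAt _ (by dsimp only; omega)
  hasDerivAt q hq := hy.hasDerivAt _ (by dsimp only; omega)

theorem hasJetAt {x₁ x₂ : ℕ → ℝ} {G : ℕ × ℕ → ℝ} (hy : IsCurveFamily K r s t₀ y)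
    (hr : HasJetAt K r t₀ x₁) (hs : HasJetAt K s t₀ x₂)
    (hG : ∀ q : ℕ × ℕ, q.1 + q.2 ≤ K → y q t₀ = G q) :
    HasJetAt K (y (0, 0)) t₀ (traceJet x₁ x₂ G) := by
  induction K generalizing y G with
  | zero =>
    have hcont : ContinuousOn (y (0, 0)) {t | ContinuousAt (y (0, 0)) t} :=
      fun t ht => ContinuousAt.continuousWithinAt ht
    refine ⟨contDiffAt_zero.2 ⟨_, hy.continuousAt (0, 0) le_rfl, hcont⟩, fun k hk => ?_⟩
    rw [Nat.le_zero.1 hk, iteratedDeriv_zero, traceJet_zero, hG _ le_rfl]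
  | succ K ih =>
    refine .of_hasDerivAt (hy.hasDerivAt (0, 0) (Nat.succ_pos K)) ?_ (by
      rw [traceJet_zero, hG _ (Nat.zero_le _)])
    have hX := ih hy.shiftX (hr.of_le K.le_succ) (hs.of_le K.le_succ)
      (G := EllipticInterface.shiftX G) fun q hq => hG _ (by dsimp only; omega)
    have hY := ih hy.shiftY (hr.of_le K.le_succ) (hs.of_le K.le_succ)
      (G := EllipticInterface.shiftY G) fun q hq => hG _ (by dsimp only; omega)
    have hjet : shift (traceJet x₁ x₂ G)
        = leibniz (shift x₁) (traceJet x₁ x₂ (EllipticInterface.shiftX G))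
          + leibniz (shift x₂) (traceJet x₁ x₂ (EllipticInterface.shiftY G)) :=
      funext fun k => traceJet_succ x₁ x₂ G k
    rw [hjet]
    exact (hr.deriv.mul hX).add (hs.deriv.mul hY)

end IsCurveFamily

theorem isCurveFamily_pderiv {F : ℝ × ℝ → ℝ} {c : ℝ → ℝ × ℝ} {r s : ℝ → ℝ} {K : ℕ} {t₀ : ℝ}
    (hF : ContDiffAt ℝ K F (c t₀)) (hc : ∀ᶠ t in 𝓝 t₀, HasDerivAt c (deriv r t, deriv s t) t) :
    IsCurveFamily K r s t₀ fun q t => pderiv q F (c t) := by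
  have hFc : ∀ᶠ t in 𝓝 t₀, ContDiffAt ℝ K F (c t) :=
    hc.self_of_nhds.continuousAt.eventually (hF.eventually (mod_cast ENat.natCast_ne_top K))
  refine ⟨fun q hq => ?_, fun q hq => ?_⟩ <;> filter_upwards [hc, hFc] with t hct hFt
  · exact (contDiffAt_pderiv (n := 0) hFt (by omega)).continuousAt.comp hct.continuousAt
  · have hchain := hasDerivAt_comp_curve
      ((contDiffAt_pderiv (n := 1) (q := q) hFt (by omega)).differentiableAt (by simp)) hct
    rwa [partialX_pderiv, (partialY_pderiv (hFt.of_le (mod_cast hq))).eq_of_nhds] at hchain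

theorem hasJetAt_flux {K : ℕ} {r s : ℝ → ℝ} {t₀ : ℝ} {a u : ℕ × ℕ → ℝ → ℝ}
    {x₁ x₂ : ℕ → ℝ} {A U : ℕ × ℕ → ℝ} (ha : IsCurveFamily K r s t₀ a)
    (hu : IsCurveFamily (K + 1) r s t₀ u) (hr : HasJetAt (K + 1) r t₀ x₁)
    (hs : HasJetAt (K + 1) s t₀ x₂) (hA : ∀ q : ℕ × ℕ, q.1 + q.2 ≤ K → a q t₀ = A q)
    (hU : ∀ q : ℕ × ℕ, q.1 + q.2 ≤ K + 1 → u q t₀ = U q) :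
    HasJetAt K (fun t => a (0, 0) t * (deriv s t * u (1, 0) t - deriv r t * u (0, 1) t)) t₀
      (fluxJet x₁ x₂ A U) := by
  have hr' := hr.of_le K.le_succ
  have hs' := hs.of_le K.le_succ
  exact (ha.hasJetAt hr' hs' hA).mul
    ((hs.deriv.mul (hu.shiftX.hasJetAt hr' hs' (G := shiftX U)
        fun q hq => hU _ (by dsimp only; omega))).sub
      (hr.deriv.mul (hu.shiftY.hasJetAt hr' hs' (G := shiftY U)
        fun q hq => hU _ (by dsimp only; omega))))

/-! ### One-sided limits -/

section LimFrom

variable {S : Set (ℝ × ℝ)} {F G : ℝ × ℝ → ℝ} {p : ℝ × ℝ}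

theorem limFrom_congr (h : Set.EqOn F G S) (p : ℝ × ℝ) : limFrom S F p = limFrom S G p := by
  rw [limFrom, limFrom, limUnder, limUnder, Filter.map_congr (h.eventuallyEq_nhdsWithin)]

theorem limFrom_eq (hp : p ∈ closure S) {L : ℝ} (h : Tendsto F (𝓝[S] p) (𝓝 L)) :
    limFrom S F p = L :=
  haveI : (𝓝[S] p).NeBot := mem_closure_iff_nhdsWithin_neBot.1 hp
  h.limUnder_eq

theorem tendsto_limFrom (hF : UniformContinuousOn F S) (hp : p ∈ closure S) :
    Tendsto F (𝓝[S] p) (𝓝 (limFrom S F p)) := by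
  have : (𝓝[S] p).NeBot := mem_closure_iff_nhdsWithin_neBot.1 hp
  have hpair : 𝓝[S] p ×ˢ 𝓝[S] p ≤ uniformity (ℝ × ℝ) ⊓ 𝓟 (S ×ˢ S) :=
    le_inf (cauchy_nhds.mono nhdsWithin_le_nhds).2 <| by
      rw [← Filter.prod_principal_principal]
      exact Filter.prod_mono inf_le_right inf_le_right
  refine tendsto_nhds_limUnder (cauchy_iff_exists_le_nhds.1 ⟨inferInstance, ?_⟩)
  rw [Filter.prod_map_map_eq]
  exact hF.mono_left hpair

theorem dist_limFrom_le {ε δ : ℝ} (hF : UniformContinuousOn F S)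
    (hε : ∀ x ∈ S, ∀ y ∈ S, dist x y < δ → dist (F x) (F y) < ε) (hp : p ∈ closure S)
    {x : ℝ × ℝ} (hx : x ∈ S) (hxp : dist x p < δ) : dist (F x) (limFrom S F p) ≤ ε := by
  have : (𝓝[S] p).NeBot := mem_closure_iff_nhdsWithin_neBot.1 hp
  have hnear : ∀ᶠ y in 𝓝[S] p, dist x y < δ :=
    nhdsWithin_le_nhds (Continuous.tendsto (by fun_prop) p |>.eventually_lt_const hxp)
  refine le_of_tendsto (tendsto_const_nhds.dist (tendsto_limFrom hF hp)) ?_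
  filter_upwards [hnear, self_mem_nhdsWithin] with y hy hyS
  exact (hε x hx y hyS hy).le

end LimFrom

theorem tendstoUniformlyOnFilter_mul_left {ι α : Type*} {l : Filter ι} {l' : Filter α}
    {f : ι → α → ℝ} {g b : α → ℝ} {b₀ : ℝ} (h : TendstoUniformlyOnFilter f g l l')
    (hb : Tendsto b l' (𝓝 b₀)) :
    TendstoUniformlyOnFilter (fun i t => b t * f i t) (fun t => b t * g t) l l' := by
  rw [Metric.tendstoUniformlyOnFilter_iff] at h ⊢
  intro ε hε
  have hC : 0 < |b₀| + 1 := by positivity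
  have hbound : ∀ᶠ x : ι × α in l ×ˢ l', |b x.2| < |b₀| + 1 :=
    tendsto_snd.eventually (hb.abs.eventually_lt_const (lt_add_one _))
  filter_upwards [h _ (div_pos hε hC), hbound] with x hx hbx
  rw [Real.dist_eq, ← mul_sub, abs_mul, ← Real.dist_eq, mul_comm]
  exact (mul_le_mul_of_nonneg_left hbx.le dist_nonneg).trans_lt ((lt_div_iff₀ hC).1 hx)

/-- The points of the curve `c` with parameters near `t₀` are moved into `S` by all small positive
multiples of `n`. -/
def PushesInto (S : Set (ℝ × ℝ)) (c : ℝ → ℝ × ℝ) (n : ℝ × ℝ) (t₀ : ℝ) : Prop :=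
  ∀ᶠ x : ℝ × ℝ in 𝓝[>] 0 ×ˢ 𝓝 t₀, c x.2 + x.1 • n ∈ S

namespace PushesInto

variable {S : Set (ℝ × ℝ)} {F : ℝ × ℝ → ℝ} {c : ℝ → ℝ × ℝ} {n : ℝ × ℝ} {t : ℝ}

theorem eventually_pushesInto (h : PushesInto S c n t) : ∀ᶠ τ in 𝓝 t, PushesInto S c n τ := by
  obtain ⟨pa, ha, pb, hb, hab⟩ := eventually_prod_iff.1 h
  exact hb.eventually_nhds.mono fun τ hτ => eventually_prod_iff.2 ⟨pa, ha, pb, hτ, hab⟩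

theorem eventually_mem (h : PushesInto S c n t) : ∀ᶠ k in 𝓝[>] (0 : ℝ), c t + k • n ∈ S :=
  h.curry.mono fun _ hk => hk.self_of_nhds

theorem mem_closure (h : PushesInto S c n t) : c t ∈ closure S := by
  have hlim : Tendsto (fun k : ℝ => c t + k • n) (𝓝[>] 0) (𝓝 (c t)) := by
    have hcont : Continuous fun k : ℝ => c t + k • n := by fun_prop
    simpa using (hcont.tendsto 0).mono_left nhdsWithin_le_nhds
  exact mem_closure_of_tendsto hlim h.eventually_mem

theorem tendstoUniformlyOnFilter (h : PushesInto S c n t) (hF : UniformContinuousOn F S) :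
    TendstoUniformlyOnFilter (fun (k : ℝ) τ => F (c τ + k • n)) (fun τ => limFrom S F (c τ))
      (𝓝[>] 0) (𝓝 t) := by
  rw [Metric.tendstoUniformlyOnFilter_iff]
  intro ε hε
  obtain ⟨δ, hδ, hFδ⟩ := Metric.uniformContinuousOn_iff.1 hF (ε / 2) (half_pos hε)
  have hsmall : ∀ᶠ k : ℝ in 𝓝[>] 0, ‖k • n‖ < δ := by
    have hcont : Continuous fun k : ℝ => ‖k • n‖ := by fun_prop
    exact nhdsWithin_le_nhds ((hcont.tendsto 0).eventually_lt_const (by simpa using hδ))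
  have hclosure : ∀ᶠ τ in 𝓝 t, c τ ∈ closure S :=
    h.eventually_pushesInto.mono fun τ hτ => hτ.mem_closure
  filter_upwards [h, tendsto_fst.eventually hsmall, tendsto_snd.eventually hclosure]
    with x hxS hxδ hxc
  rw [dist_comm]
  exact (dist_limFrom_le hF hFδ hxc hxS (by simpa [dist_eq_norm] using hxδ)).trans_lt
    (half_lt_self hε)

theorem continuousAt_limFrom (h : PushesInto S c n t) (hS : IsOpen S)
    (hF : UniformContinuousOn F S) (hc : ContinuousAt c t) :
    ContinuousAt (fun τ => limFrom S F (c τ)) t := by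
  have hunif := h.tendstoUniformlyOnFilter hF
  refine hunif.tendsto_of_eventually_tendsto (L := fun k : ℝ => F (c t + k • n))
    (h.eventually_mem.mono fun k hk => ?_) (hunif.tendsto_at ?_)
  · exact Tendsto.comp (hF.continuousOn.continuousAt (hS.mem_nhds hk))
      (hc.tendsto.add_const (k • n))
  · exact (principal_singleton t).trans_le (pure_le_nhds t)

/-- The one-sided limits along `c` are locally uniform limits of the values along the curves
`c + k • n`, `k > 0`, which lie in `S`, and so are their derivatives. -/
theorem hasDerivAt_limFrom (h : PushesInto S c n t) (hS : IsOpen S) (hd : DifferentiableOn ℝ F S)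
    (hF : UniformContinuousOn F S) (hX : UniformContinuousOn (partialX F) S)
    (hY : UniformContinuousOn (partialY F) S) {v : ℝ → ℝ × ℝ}
    (hc : ∀ᶠ τ in 𝓝 t, HasDerivAt c (v τ) τ) (hv : ContinuousAt v t) :
    HasDerivAt (fun τ => limFrom S F (c τ))
      ((v t).1 * limFrom S (partialX F) (c t) + (v t).2 * limFrom S (partialY F) (c t)) t := by
  refine hasDerivAt_of_tendstoUniformlyOnFilter (l := 𝓝[>] (0 : ℝ))
    (f := fun k τ => F (c τ + k • n))
    (f' := fun k τ => (v τ).1 * partialX F (c τ + k • n) + (v τ).2 * partialY F (c τ + k • n))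
    (g' := fun τ => (v τ).1 * limFrom S (partialX F) (c τ) + (v τ).2 * limFrom S (partialY F) (c τ))
    ?_ ?_ ?_
  · have hX' := tendstoUniformlyOnFilter_mul_left (h.tendstoUniformlyOnFilter hX)
      hv.tendsto.fst_nhds
    have hY' := tendstoUniformlyOnFilter_mul_left (h.tendstoUniformlyOnFilter hY)
      hv.tendsto.snd_nhds
    simpa only [Pi.add_def] using hX'.add hY'
  · filter_upwards [h, tendsto_snd.eventually hc] with x hx hcx
    exact hasDerivAt_comp_curve (c := fun τ => c τ + x.1 • n)
      (hd.differentiableAt (hS.mem_nhds hx)) (hcx.add_const _)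
  · exact h.eventually_pushesInto.mono fun τ hτ =>
      (hτ.tendstoUniformlyOnFilter hF).tendsto_at
        ((principal_singleton τ).trans_le (pure_le_nhds τ))

end PushesInto

theorem UniformlySmoothOn.isCurveFamily {S : Set (ℝ × ℝ)} {F : ℝ × ℝ → ℝ} {K : ℕ}
    (hF : UniformlySmoothOn K F S) (hS : IsOpen S) {c : ℝ → ℝ × ℝ} {n : ℝ × ℝ} {t₀ : ℝ}
    (h : PushesInto S c n t₀) {r s : ℝ → ℝ}
    (hc : ∀ᶠ t in 𝓝 t₀, HasDerivAt c (deriv r t, deriv s t) t)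
    (hv : ∀ᶠ t in 𝓝 t₀, ContinuousAt (fun τ => (deriv r τ, deriv s τ)) t) :
    IsCurveFamily K r s t₀ fun q t => limFrom S (pderiv q F) (c t) := by
  have hcont (z) (hz : z ∈ S) : ContDiffAt ℝ K F z := hF.1.contDiffAt (hS.mem_nhds hz)
  refine ⟨fun q hq => ?_, fun q hq => ?_⟩
  · filter_upwards [h.eventually_pushesInto, hc] with t ht hct
    exact ht.continuousAt_limFrom hS (hF.2 q (mem_Lam.2 hq)) hct.continuousAt
  · have hd : DifferentiableOn ℝ (pderiv q F) S := fun z hz =>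
      ((contDiffAt_pderiv (n := 1) (q := q) (hcont z hz) (by omega)).differentiableAt
        (by simp)).differentiableWithinAt
    have hX : UniformContinuousOn (partialX (pderiv q F)) S := by
      rw [partialX_pderiv]
      exact hF.2 _ (mem_Lam.2 (by dsimp only; omega))
    have hYeq : Set.EqOn (pderiv (q.1, q.2 + 1) F) (partialY (pderiv q F)) S := fun z hz =>
      ((partialY_pderiv ((hcont z hz).of_le (mod_cast hq))).eq_of_nhds).symm
    have hY := (hF.2 (q.1, q.2 + 1) (mem_Lam.2 (by dsimp only; omega))).congr hYeq
    filter_upwards [h.eventually_pushesInto, hc.eventually_nhds, hv] with t ht hct hvt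
    have hchain := ht.hasDerivAt_limFrom hS hd (hF.2 q (mem_Lam.2 hq.le)) hX hY hct hvt
    rwa [partialX_pderiv, ← limFrom_congr hYeq] at hchain

/-- The equation `-∇ · (a ∇u) = f` in an open set, with data that are smooth up to the boundary. -/
structure SolvesOn (M : ℕ) (S : Set (ℝ × ℝ)) (a u f : ℝ × ℝ → ℝ) : Prop where
  isOpen : IsOpen S
  smooth_a : UniformlySmoothOn M a S
  smooth_u : UniformlySmoothOn (M + 1) u S
  smooth_f : UniformlySmoothOn (M - 1) f S
  pde : ∀ z ∈ S, -(partialX (fun z => a z * partialX u z) z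
    + partialY (fun z => a z * partialY u z) z) = f z

namespace SolvesOn

variable {M : ℕ} {S : Set (ℝ × ℝ)} {a u f : ℝ × ℝ → ℝ} {p : ℝ × ℝ}

theorem ellipticJet_pderiv (h : SolvesOn M S a u f) {z : ℝ × ℝ} (hz : z ∈ S) {q : ℕ × ℕ}
    (hq : q.1 + q.2 + 1 ≤ M) :
    ellipticJet (fun q => pderiv q a z) (fun q => pderiv q u z) q = -pderiv q f z := by
  have hS := h.isOpen.mem_nhds hz
  have hpde : f =ᶠ[𝓝 z] fun z => -(partialX (fun z => a z * partialX u z) z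
      + partialY (fun z => a z * partialY u z) z) :=
    eventually_of_mem hS fun z hz => (h.pde z hz).symm
  rw [(pderiv_congr hpde q).eq_of_nhds, pderiv_neg, neg_neg, pderiv_divergence
    ((h.smooth_a.1.contDiffAt hS).of_le (mod_cast hq))
    ((h.smooth_u.1.contDiffAt hS).of_le (by norm_cast; omega))]

theorem ellipticJet_limFrom (h : SolvesOn M S a u f) (hp : p ∈ closure S) {A : ℕ × ℕ → ℝ}
    (hA : ∀ q ∈ Lam M, limFrom S (pderiv q a) p = A q) {q : ℕ × ℕ} (hq : q.1 + q.2 + 1 ≤ M) :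
    ellipticJet A (fun q => limFrom S (pderiv q u) p) q = -limFrom S (pderiv q f) p := by
  have : (𝓝[S] p).NeBot := mem_closure_iff_nhdsWithin_neBot.1 hp
  have ha (q' : ℕ × ℕ) (hq' : q'.1 + q'.2 ≤ M) : Tendsto (pderiv q' a) (𝓝[S] p) (𝓝 (A q')) :=
    hA q' (mem_Lam.2 hq') ▸ tendsto_limFrom (h.smooth_a.2 q' (mem_Lam.2 hq')) hp
  have hu (q' : ℕ × ℕ) (hq' : q'.1 + q'.2 ≤ M + 1) :=
    tendsto_limFrom (h.smooth_u.2 q' (mem_Lam.2 hq')) hp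
  have hf := (tendsto_limFrom (h.smooth_f.2 q (mem_Lam.2 (by omega))) hp).neg
  refine tendsto_nhds_unique (f := fun z => ellipticJet (fun q => pderiv q a z)
    (fun q => pderiv q u z) q) ?_ (hf.congr' ?_)
  · simp only [ellipticJet_apply, leibniz₂_apply, shiftX_apply, shiftY_apply]
    refine .add ?_ ?_ <;>
    · refine tendsto_finsetSum _ fun i hi => tendsto_finsetSum _ fun j hj => ?_
      rw [Finset.mem_range] at hi hj
      exact (tendsto_const_nhds.mul (ha _ (by dsimp only; omega))).mul
        (hu _ (by dsimp only; omega))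
  · exact eventually_nhdsWithin_of_forall fun z hz => (h.ellipticJet_pderiv hz hq).symm

theorem limFrom_flux (h : SolvesOn M S a u f) (hp : p ∈ closure S) (n : ℝ × ℝ) :
    limFrom S (fun z => a z * (partialX u z * n.1 + partialY u z * n.2)) p
      = limFrom S a p * (limFrom S (partialX u) p * n.1 + limFrom S (partialY u) p * n.2) :=
  limFrom_eq hp <| (tendsto_limFrom (h.smooth_a.2 (0, 0) (mem_Lam.2 (Nat.zero_le _))) hp).mul <|
    .add ((tendsto_limFrom (h.smooth_u.2 (1, 0) (mem_Lam.2 (by simp))) hp).mul_const _)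
      ((tendsto_limFrom (h.smooth_u.2 (0, 1) (mem_Lam.2 (by simp))) hp).mul_const _)

end SolvesOn

/-! ### The normal along the interface -/

section NormedSpace

variable {E : Type*} [NormedAddCommGroup E] [NormedSpace ℝ E]

theorem tendsto_add_smul (p w : E) :
    Tendsto (fun x : ℝ × E => x.2 + x.1 • w) (𝓝[>] 0 ×ˢ 𝓝 p) (𝓝 p) := by
  have hcont : Continuous fun x : ℝ × E => x.2 + x.1 • w := by fun_prop
  have hlim := hcont.tendsto (0, p)
  rw [zero_smul, add_zero, nhds_prod_eq] at hlim
  exact hlim.mono_left (Filter.prod_mono nhdsWithin_le_nhds le_rfl)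

theorem eventually_lt_add_smul {φ : E → ℝ} {L : E →L[ℝ] ℝ} {p w : E}
    (h : HasStrictFDerivAt φ L p) (hw : 0 < L w) :
    ∀ᶠ x : ℝ × E in 𝓝[>] 0 ×ˢ 𝓝 p, φ x.2 < φ (x.2 + x.1 • w) := by
  have hw₀ : 0 < ‖w‖ := norm_pos_iff.2 fun h0 => by simp [h0] at hw
  have hslope : 0 < L w / (2 * ‖w‖) := by positivity
  have hlinear := ((tendsto_add_smul p w).prodMk_nhds tendsto_snd).eventually
    (h.isLittleO.def hslope)
  have hpos : ∀ᶠ k : ℝ in 𝓝[>] 0, 0 < k := self_mem_nhdsWithin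
  filter_upwards [hlinear, tendsto_fst.eventually hpos] with x hx hk
  have herror : L w / (2 * ‖w‖) * ‖x.1 • w‖ = x.1 * L w / 2 := by
    rw [norm_smul, Real.norm_of_nonneg hk.le]
    field_simp
  rw [add_sub_cancel_left, herror, map_smul, smul_eq_mul, Real.norm_eq_abs] at hx
  linarith [(abs_le.1 hx).1, mul_pos hk hw]

end NormedSpace

namespace IsUnitNormal

variable {ψ : ℝ × ℝ → ℝ} {p n w : ℝ × ℝ}

theorem neg (h : IsUnitNormal ψ p n) : IsUnitNormal (-ψ) p (-n) := by
  obtain ⟨hn, φ, hφ, hsign, hgrad⟩ := h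
  refine ⟨by simpa using hn, -φ, hφ.neg, ?_, fun v => ?_⟩
  · simpa [and_comm] using hsign
  · rw [fderiv_neg, neg_apply, hgrad, Prod.fst_neg, Prod.snd_neg]
    ring

theorem eventually_pos (h : IsUnitNormal ψ p n) (hw : 0 < n.1 * w.1 + n.2 * w.2) :
    ∀ᶠ x : ℝ × (ℝ × ℝ) in 𝓝[>] 0 ×ˢ 𝓝 p, ψ x.2 = 0 → 0 < ψ (x.2 + x.1 • w) := by
  obtain ⟨-, φ, hφ, hsign, hgrad⟩ := h
  have hlt := eventually_lt_add_smul (hφ.hasStrictFDerivAt one_ne_zero)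
    (hw.trans_eq (hgrad w).symm)
  filter_upwards [hlt, tendsto_snd.eventually hsign, (tendsto_add_smul p w).eventually hsign]
    with x hlt hx hxw hψ
  exact hxw.1.1 ((not_lt.1 fun h => (hx.2.1 h).ne hψ).trans_lt hlt)

theorem eventually_neg (h : IsUnitNormal ψ p n) (hw : n.1 * w.1 + n.2 * w.2 < 0) :
    ∀ᶠ x : ℝ × (ℝ × ℝ) in 𝓝[>] 0 ×ˢ 𝓝 p, ψ x.2 = 0 → ψ (x.2 + x.1 • w) < 0 := by
  have hpos := h.neg.eventually_pos (w := w) (by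
    rw [Prod.fst_neg, Prod.snd_neg]
    linarith)
  simpa using hpos

theorem inner_self_pos (h : IsUnitNormal ψ p n) : 0 < n.1 * n.1 + n.2 * n.2 := by
  nlinarith only [h.1]

theorem orthogonal {c : ℝ → ℝ × ℝ} {t : ℝ} {v : ℝ × ℝ} (h : IsUnitNormal ψ (c t) n)
    (hc : HasDerivAt c v t) (hψ : ∀ᶠ τ in 𝓝 t, ψ (c τ) = 0) : n.1 * v.1 + n.2 * v.2 = 0 := by
  obtain ⟨-, φ, hφ, hsign, hgrad⟩ := h
  have hchain : HasDerivAt (fun τ => φ (c τ)) (fderiv ℝ φ (c t) v) t :=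
    (hφ.differentiableAt one_ne_zero).hasFDerivAt.comp_hasDerivAt t hc
  have hzero : (fun τ => φ (c τ)) =ᶠ[𝓝 t] fun _ => 0 := by
    filter_upwards [hψ, hc.continuousAt.eventually hsign] with τ hτ hs
    exact le_antisymm (not_lt.1 fun h => (hs.1.1 h).ne' hτ) (not_lt.1 fun h => (hs.2.1 h).ne hτ)
  rw [← hgrad, ← hchain.deriv, hzero.deriv_eq, deriv_const]

theorem eventually_inner_nonneg {N : ℝ × ℝ → ℝ × ℝ} (h : IsUnitNormal ψ p (N p)) :
    ∀ᶠ q in 𝓝 p, ψ q = 0 → IsUnitNormal ψ q (N q) →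
      0 ≤ (N q).1 * (N p).1 + (N q).2 * (N p).2 := by
  have hpos := (eventually_swap_iff.1 (h.eventually_pos h.inner_self_pos)).curry
  filter_upwards [hpos] with q hq hψ hN
  by_contra! hneg
  have hside : ∀ᶠ k in 𝓝[>] (0 : ℝ), ψ (q + k • N p) < 0 :=
    (hN.eventually_neg hneg).curry.mono fun k hk => hk.self_of_nhds hψ
  obtain ⟨k, hkpos, hkneg⟩ := (hq.and hside).exists
  exact (hkpos hψ).asymm hkneg

end IsUnitNormal

theorem mul_norm_eq_sign_cross_mul {m n v w : ℝ × ℝ} (hm : m.1 ^ 2 + m.2 ^ 2 = 1)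
    (hn : n.1 ^ 2 + n.2 ^ 2 = 1) (hmv : m.1 * v.1 + m.2 * v.2 = 0)
    (hnw : n.1 * w.1 + n.2 * w.2 = 0) (hmn : 0 ≤ m.1 * n.1 + m.2 * n.2)
    (hvw : 0 < v.1 * w.1 + v.2 * w.2) :
    m.1 * √(v.1 ^ 2 + v.2 ^ 2) = Real.sign (n.1 * w.2 - n.2 * w.1) * v.2 ∧
      m.2 * √(v.1 ^ 2 + v.2 ^ 2) = -(Real.sign (n.1 * w.2 - n.2 * w.1) * v.1) := by
  set X := m.1 * v.2 - m.2 * v.1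
  set Y := n.1 * w.2 - n.2 * w.1
  have hv₁ : v.1 = -(m.2 * X) := by linear_combination (-v.1) * hm + m.1 * hmv
  have hv₂ : v.2 = m.1 * X := by linear_combination (-v.2) * hm + m.2 * hmv
  have hw₁ : w.1 = -(n.2 * Y) := by linear_combination (-w.1) * hn + n.1 * hnw
  have hw₂ : w.2 = n.1 * Y := by linear_combination (-w.2) * hn + n.2 * hnw
  have hXY : 0 < X * Y := by
    refine pos_of_mul_pos_left (b := m.1 * n.1 + m.2 * n.2) (hvw.trans_eq ?_) hmn
    rw [hv₁, hv₂, hw₁, hw₂]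
    ring
  have hnorm : √(v.1 ^ 2 + v.2 ^ 2) = |X| := by
    rw [← Real.sqrt_sq_eq_abs, hv₁, hv₂]
    congr 1
    linear_combination X ^ 2 * hm
  have hsign : |X| = Real.sign Y * X := by
    rcases pos_and_pos_or_neg_and_neg_of_mul_pos hXY with ⟨hXpos, hYpos⟩ | ⟨hXneg, hYneg⟩
    · rw [Real.sign_of_pos hYpos, abs_of_pos hXpos, one_mul]
    · rw [Real.sign_of_neg hYneg, abs_of_neg hXneg, neg_one_mul]
  rw [hnorm, hsign]
  exact ⟨by rw [hv₂]; ring, by rw [hv₁]; ring⟩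

/-! ### Solutions satisfy the transmission relations -/

namespace InterfaceData

variable {P : InterfaceData} {M : ℕ} {p : ℝ × ℝ} {r s : ℝ → ℝ}

theorem isOpen_domain : IsOpen P.domain := isOpen_Ioo.prod isOpen_Ioo

/-- The curve `t ↦ p + (r t, s t)`. -/
def curve (p : ℝ × ℝ) (r s : ℝ → ℝ) (t : ℝ) : ℝ × ℝ := (p.1 + r t, p.2 + s t)

namespace IsLocalParam

theorem curve_zero (hl : P.IsLocalParam M p r s) : curve p r s 0 = p := by
  rw [curve, hl.1, hl.2.1, add_zero, add_zero]

theorem eventually_contDiffAt (hl : P.IsLocalParam M p r s) :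
    ∀ᶠ t in 𝓝 0, ContDiffAt ℝ (M + 1 : ℕ) r t ∧ ContDiffAt ℝ (M + 1 : ℕ) s t := by
  obtain ⟨-, -, ε, hε, hr, hs, -⟩ := hl
  filter_upwards [Ioo_mem_nhds (neg_lt_zero.2 hε) hε] with t ht
  exact ⟨hr.contDiffAt (isOpen_Ioo.mem_nhds ht), hs.contDiffAt (isOpen_Ioo.mem_nhds ht)⟩

theorem eventually_pos_and_mem (hl : P.IsLocalParam M p r s) :
    ∀ᶠ t in 𝓝 0, 0 < deriv r t ^ 2 + deriv s t ^ 2 ∧ curve p r s t ∈ P.interface := by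
  obtain ⟨-, -, ε, hε, -, -, h⟩ := hl
  filter_upwards [Ioo_mem_nhds (neg_lt_zero.2 hε) hε] with t ht using h t ht

theorem mem_interface (hl : P.IsLocalParam M p r s) : p ∈ P.interface :=
  hl.curve_zero ▸ hl.eventually_pos_and_mem.self_of_nhds.2

theorem eventually_hasDerivAt (hl : P.IsLocalParam M p r s) :
    ∀ᶠ t in 𝓝 0, HasDerivAt (curve p r s) (deriv r t, deriv s t) t :=
  hl.eventually_contDiffAt.mono fun _ h =>
    ((h.1.differentiableAt (by simp)).hasDerivAt.const_add _).prodMk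
      ((h.2.differentiableAt (by simp)).hasDerivAt.const_add _)

theorem eventually_continuousAt_deriv (hl : P.IsLocalParam M p r s) :
    ∀ᶠ t in 𝓝 0, ContinuousAt (fun τ => (deriv r τ, deriv s τ)) t :=
  hl.eventually_contDiffAt.mono fun _ h =>
    (h.1.derivWithin (m := 0) (by simp)).continuousAt.prodMk
      (h.2.derivWithin (m := 0) (by simp)).continuousAt

theorem tendsto_curve (hl : P.IsLocalParam M p r s) : Tendsto (curve p r s) (𝓝 0) (𝓝 p) := by
  have hcont := hl.eventually_hasDerivAt.self_of_nhds.continuousAt.tendsto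
  rwa [hl.curve_zero] at hcont

theorem hasJetAt_r (hl : P.IsLocalParam M p r s) :
    HasJetAt (M + 1) r 0 (P.jet M p r s).rJet :=
  ⟨hl.eventually_contDiffAt.self_of_nhds.1, fun _ hk =>
    (Jet.rJet_apply (P.jet M p r s) (by omega)).symm⟩

theorem hasJetAt_s (hl : P.IsLocalParam M p r s) :
    HasJetAt (M + 1) s 0 (P.jet M p r s).sJet :=
  ⟨hl.eventually_contDiffAt.self_of_nhds.2, fun _ hk =>
    (Jet.sJet_apply (P.jet M p r s) (by omega)).symm⟩

theorem hasJetAt_speed (hl : P.IsLocalParam M p r s) :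
    HasJetAt M (fun t => √(deriv r t ^ 2 + deriv s t ^ 2)) 0 (P.jet M p r s).speedJet := by
  simp only [pow_two]
  refine ((hl.hasJetAt_r.deriv.mul hl.hasJetAt_r.deriv).add
    (hl.hasJetAt_s.deriv.mul hl.hasJetAt_s.deriv)).sqrt ?_
  simpa only [pow_two] using hl.eventually_pos_and_mem.self_of_nhds.1

end IsLocalParam

namespace IsSolution

theorem solvesOn_plus (hP : P.IsSolution M) : SolvesOn M P.regionPlus P.a P.u P.f where
  isOpen := hP.continuousOn_ψ.isOpen_inter_preimage isOpen_domain isOpen_Ioi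
  smooth_a := hP.a_plus
  smooth_u := hP.u_plus
  smooth_f := hP.f_plus
  pde z hz := hP.pde z ⟨hz.1, fun h => hz.2.ne' h.2⟩

theorem solvesOn_minus (hP : P.IsSolution M) : SolvesOn M P.regionMinus P.a P.u P.f where
  isOpen := hP.continuousOn_ψ.isOpen_inter_preimage isOpen_domain isOpen_Iio
  smooth_a := hP.a_minus
  smooth_u := hP.u_minus
  smooth_f := hP.f_minus
  pde z hz := hP.pde z ⟨hz.1, fun h => hz.2.ne h.2⟩

theorem pushesInto_plus (hP : P.IsSolution M) (hl : P.IsLocalParam M p r s) :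
    PushesInto P.regionPlus (curve p r s) (P.normal p) 0 := by
  have hn := hP.normal_spec p hl.mem_interface
  have hlim := (tendsto_id (x := 𝓝[>] (0 : ℝ))).prodMap hl.tendsto_curve
  filter_upwards [hlim.eventually (hn.eventually_pos hn.inner_self_pos),
    hlim.eventually ((tendsto_add_smul p (P.normal p)).eventually
      (isOpen_domain.mem_nhds hl.mem_interface.1)),
    tendsto_snd.eventually hl.eventually_pos_and_mem] with x hx hdom hmem
  exact ⟨hdom, hx hmem.2.2⟩

theorem pushesInto_minus (hP : P.IsSolution M) (hl : P.IsLocalParam M p r s) :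
    PushesInto P.regionMinus (curve p r s) (-P.normal p) 0 := by
  have hn := hP.normal_spec p hl.mem_interface
  have hlim := (tendsto_id (x := 𝓝[>] (0 : ℝ))).prodMap hl.tendsto_curve
  have hneg : (P.normal p).1 * (-P.normal p).1 + (P.normal p).2 * (-P.normal p).2 < 0 := by
    rw [Prod.fst_neg, Prod.snd_neg]
    linarith [hn.inner_self_pos]
  filter_upwards [hlim.eventually (hn.eventually_neg hneg),
    hlim.eventually ((tendsto_add_smul p (-P.normal p)).eventually
      (isOpen_domain.mem_nhds hl.mem_interface.1)),
    tendsto_snd.eventually hl.eventually_pos_and_mem] with x hx hdom hmem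
  exact ⟨hdom, hx hmem.2.2⟩

theorem eventually_orthogonal (hP : P.IsSolution M) (hl : P.IsLocalParam M p r s) :
    ∀ᶠ t in 𝓝 0, (P.normal (curve p r s t)).1 * deriv r t
      + (P.normal (curve p r s t)).2 * deriv s t = 0 := by
  filter_upwards [hl.eventually_hasDerivAt, hl.eventually_pos_and_mem.eventually_nhds]
    with t hct hmem
  exact (hP.normal_spec _ hmem.self_of_nhds.2).orthogonal hct (hmem.mono fun τ hτ => hτ.2.2)

theorem orientation_mul_self (hP : P.IsSolution M) (hl : P.IsLocalParam M p r s) :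
    P.orientation p r s * P.orientation p r s = 1 := by
  have hn := hP.normal_spec p hl.mem_interface
  have horth := (hP.eventually_orthogonal hl).self_of_nhds
  have hspeed := hl.eventually_pos_and_mem.self_of_nhds.1
  rw [hl.curve_zero] at horth
  have hcross : (P.normal p).1 * deriv s 0 - (P.normal p).2 * deriv r 0 ≠ 0 := fun h => by
    refine hspeed.ne ?_
    linear_combination (deriv r 0 ^ 2 + deriv s 0 ^ 2) * hn.1
      - ((P.normal p).1 * deriv r 0 + (P.normal p).2 * deriv s 0) * horth
      - ((P.normal p).1 * deriv s 0 - (P.normal p).2 * deriv r 0) * h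
  rcases Real.sign_apply_eq_of_ne_zero _ hcross with h | h <;> rw [orientation, h] <;> norm_num

theorem eventually_normal (hP : P.IsSolution M) (hl : P.IsLocalParam M p r s) :
    ∀ᶠ t in 𝓝 0,
      (P.normal (curve p r s t)).1 * √(deriv r t ^ 2 + deriv s t ^ 2)
          = P.orientation p r s * deriv s t ∧
        (P.normal (curve p r s t)).2 * √(deriv r t ^ 2 + deriv s t ^ 2)
          = -(P.orientation p r s * deriv r t) := by
  have hn := hP.normal_spec p hl.mem_interface
  have horth := hP.eventually_orthogonal hl
  have horth₀ := horth.self_of_nhds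
  rw [hl.curve_zero] at horth₀
  have hturn : ∀ᶠ t in 𝓝 0, 0 < deriv r t * deriv r 0 + deriv s t * deriv s 0 := by
    have hcont := hl.eventually_continuousAt_deriv.self_of_nhds
    refine ((hcont.fst.mul_const _).add (hcont.snd.mul_const _)).tendsto.eventually_const_lt ?_
    simpa only [pow_two, Pi.add_apply] using hl.eventually_pos_and_mem.self_of_nhds.1
  filter_upwards [hl.eventually_pos_and_mem, horth, hturn,
    hl.tendsto_curve.eventually hn.eventually_inner_nonneg] with t hmem ht hvt hnt
  have hN := hP.normal_spec _ hmem.2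
  exact mul_norm_eq_sign_cross_mul (v := (deriv r t, deriv s t)) (w := (deriv r 0, deriv s 0))
    hN.1 hn.1 ht horth₀ (hnt hmem.2.2 hN) hvt

theorem eventually_jump_u (hP : P.IsSolution M) (hl : P.IsLocalParam M p r s) :
    ∀ᶠ t in 𝓝 0, limFrom P.regionPlus P.u (curve p r s t)
      = limFrom P.regionMinus P.u (curve p r s t) + P.gD (curve p r s t) :=
  hl.eventually_pos_and_mem.mono fun _ ht => sub_eq_iff_eq_add'.1 (hP.jump_u _ ht.2)

theorem eventually_jump_flux (hP : P.IsSolution M) (hl : P.IsLocalParam M p r s) :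
    ∀ᶠ t in 𝓝 0,
      limFrom P.regionPlus P.a (curve p r s t)
          * (deriv s t * limFrom P.regionPlus (partialX P.u) (curve p r s t)
            - deriv r t * limFrom P.regionPlus (partialY P.u) (curve p r s t))
        = limFrom P.regionMinus P.a (curve p r s t)
            * (deriv s t * limFrom P.regionMinus (partialX P.u) (curve p r s t)
              - deriv r t * limFrom P.regionMinus (partialY P.u) (curve p r s t))
          + √(deriv r t ^ 2 + deriv s t ^ 2)
            * (P.orientation p r s * P.gN (curve p r s t)) := by
  filter_upwards [hl.eventually_pos_and_mem, hP.eventually_normal hl,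
    (hP.pushesInto_plus hl).eventually_pushesInto, (hP.pushesInto_minus hl).eventually_pushesInto]
    with t ht hnormal hplus hminus
  have hjump := hP.jump_flux _ ht.2
  rw [jump, hP.solvesOn_plus.limFrom_flux hplus.mem_closure,
    hP.solvesOn_minus.limFrom_flux hminus.mem_closure] at hjump
  have hσ := hP.orientation_mul_self hl
  obtain ⟨hn₁, hn₂⟩ := hnormal
  rw [← hjump]
  generalize P.orientation p r s = σ at *
  generalize limFrom P.regionPlus P.a (curve p r s t) = a₁
  generalize limFrom P.regionMinus P.a (curve p r s t) = a₂
  generalize limFrom P.regionPlus (partialX P.u) (curve p r s t) = x₁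
  generalize limFrom P.regionMinus (partialX P.u) (curve p r s t) = x₂
  generalize limFrom P.regionPlus (partialY P.u) (curve p r s t) = y₁
  generalize limFrom P.regionMinus (partialY P.u) (curve p r s t) = y₂
  linear_combination (-σ * (a₁ * x₁ - a₂ * x₂)) * hn₁ - σ * (a₁ * y₁ - a₂ * y₂) * hn₂
    - (a₁ * x₁ * deriv s t - a₂ * x₂ * deriv s t - a₁ * y₁ * deriv r t + a₂ * y₂ * deriv r t) * hσ

theorem jet_regular (hP : P.IsSolution M) (hl : P.IsLocalParam M p r s) :
    (P.jet M p r s).Regular := by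
  have hspeed := hl.eventually_pos_and_mem.self_of_nhds.1
  have ha := hP.a_pos_interface p hl.mem_interface
  refine ⟨fun h => ?_, ?_, ?_⟩
  · obtain ⟨hs, hr⟩ := Complex.ext_iff.1 h
    rw [tangent, ← hl.hasJetAt_s.2 1 (by omega), iteratedDeriv_one] at hs
    rw [tangent, ← hl.hasJetAt_r.2 1 (by omega), iteratedDeriv_one] at hr
    refine hspeed.ne' ?_
    simp only at hs hr
    rw [hs, hr]
    norm_num
  · rw [Jet.aPlusJet_apply _ (mem_Lam.2 (Nat.zero_le _))]
    exact ha.1.ne'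
  · rw [Jet.aMinusJet_apply _ (mem_Lam.2 (Nat.zero_le _))]
    exact ha.2.ne'

end IsSolution

/-- The derivatives at `p` of all data of the problem, where `gN` is taken with the sign `σ`. -/
def derivatives (P : InterfaceData) (p : ℝ × ℝ) (σ : ℝ) : JetSpace
  | .uPlus => P.derivPlus P.u p
  | .uMinus => P.derivMinus P.u p
  | .fPlus => P.derivPlus P.f p
  | .fMinus => P.derivMinus P.f p
  | .gD => fun q => pderiv q P.gD p
  | .gN => fun q => σ * pderiv q P.gN p

section Transmission

variable {S : Set (ℝ × ℝ)} {n : ℝ × ℝ} {F : ℝ × ℝ → ℝ}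

theorem IsLocalParam.isCurveFamily_limFrom (hl : P.IsLocalParam M p r s) {K : ℕ}
    (hF : UniformlySmoothOn K F S) (hS : IsOpen S) (hn : PushesInto S (curve p r s) n 0) :
    IsCurveFamily K r s 0 fun q t => limFrom S (pderiv q F) (curve p r s t) :=
  hF.isCurveFamily hS hn hl.eventually_hasDerivAt hl.eventually_continuousAt_deriv

theorem IsLocalParam.hasJetAt_limFrom (hl : P.IsLocalParam M p r s)
    (hF : UniformlySmoothOn (M + 1) F S) (hS : IsOpen S) (hn : PushesInto S (curve p r s) n 0) :
    HasJetAt (M + 1) (fun t => limFrom S F (curve p r s t)) 0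
      (traceJet (P.jet M p r s).rJet (P.jet M p r s).sJet fun q => limFrom S (pderiv q F) p) :=
  (hl.isCurveFamily_limFrom hF hS hn).hasJetAt hl.hasJetAt_r hl.hasJetAt_s fun q _ => by
    rw [hl.curve_zero]

theorem IsLocalParam.hasJetAt_flux (hl : P.IsLocalParam M p r s) {a u f : ℝ × ℝ → ℝ}
    (h : SolvesOn M S a u f) (hn : PushesInto S (curve p r s) n 0) {A : ℕ × ℕ → ℝ}
    (hA : ∀ q ∈ Lam M, limFrom S (pderiv q a) p = A q) :
    HasJetAt M (fun t => limFrom S a (curve p r s t)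
        * (deriv s t * limFrom S (partialX u) (curve p r s t)
          - deriv r t * limFrom S (partialY u) (curve p r s t))) 0
      (fluxJet (P.jet M p r s).rJet (P.jet M p r s).sJet A fun q => limFrom S (pderiv q u) p) :=
  EllipticInterface.hasJetAt_flux (hl.isCurveFamily_limFrom h.smooth_a h.isOpen hn)
    (hl.isCurveFamily_limFrom h.smooth_u h.isOpen hn) hl.hasJetAt_r hl.hasJetAt_s
    (fun q hq => by rw [hl.curve_zero, hA q (mem_Lam.2 hq)]) fun q _ => by rw [hl.curve_zero]

theorem IsLocalParam.hasJetAt_comp (hl : P.IsLocalParam M p r s) {K : ℕ} (hK : K ≤ M + 1)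
    (hF : ContDiffAt ℝ K F p) : HasJetAt K (fun t => F (curve p r s t)) 0
      (traceJet (P.jet M p r s).rJet (P.jet M p r s).sJet fun q => pderiv q F p) :=
  (isCurveFamily_pderiv (hl.curve_zero.symm ▸ hF) hl.eventually_hasDerivAt).hasJetAt
    (hl.hasJetAt_r.of_le hK) (hl.hasJetAt_s.of_le hK) fun q _ => by rw [hl.curve_zero]

theorem IsSolution.transmits (hP : P.IsSolution M) (hl : P.IsLocalParam M p r s)
    (hD : ContDiffAt ℝ (M + 1 : ℕ) P.gD p) (hN : ContDiffAt ℝ M P.gN p) :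
    (P.jet M p r s).Transmits (P.derivatives p (P.orientation p r s)) := by
  have hplus := hP.pushesInto_plus hl
  have hminus := hP.pushesInto_minus hl
  have haPlus (q) (hq : q ∈ Lam M) : P.derivPlus P.a p q = (P.jet M p r s).aPlusJet q :=
    (Jet.aPlusJet_apply (P.jet M p r s) hq).symm
  have haMinus (q) (hq : q ∈ Lam M) : P.derivMinus P.a p q = (P.jet M p r s).aMinusJet q :=
    (Jet.aMinusJet_apply (P.jet M p r s) hq).symm
  constructor
  · exact fun q hq => hP.solvesOn_plus.ellipticJet_limFrom
      (hl.curve_zero ▸ hplus.mem_closure) haPlus hq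
  · exact fun q hq => hP.solvesOn_minus.ellipticJet_limFrom
      (hl.curve_zero ▸ hminus.mem_closure) haMinus hq
  · exact fun k hk => (hl.hasJetAt_limFrom hP.u_plus hP.solvesOn_plus.isOpen hplus).unique
      ((hl.hasJetAt_limFrom hP.u_minus hP.solvesOn_minus.isOpen hminus).add
        (hl.hasJetAt_comp le_rfl hD)) (hP.eventually_jump_u hl) hk
  · intro k hk
    have hgN := (hl.hasJetAt_comp M.le_succ hN).const_mul (P.orientation p r s)
    rw [← map_smul] at hgN
    exact (hl.hasJetAt_flux hP.solvesOn_plus hplus haPlus).unique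
      ((hl.hasJetAt_flux hP.solvesOn_minus hminus haMinus).add (hl.hasJetAt_speed.mul hgN))
      (hP.eventually_jump_flux hl) hk

end Transmission

end InterfaceData

end EllipticInterface

end

theorem theorem2p7 (M : ℕ) (hM : 1 ≤ M) :
    ∃ TuPlus TfPlus TfMinus TgD TgN : EllipticInterface.Jet M → ℕ × ℕ → ℕ × ℕ → ℝ,
      -- the transmission equation, for all problems, base points and parametrizations
      (∀ (P : EllipticInterface.InterfaceData) (p : ℝ × ℝ) (r s : ℝ → ℝ),
        P.IsSolution M → p ∈ P.interface → P.IsLocalParam M p r s →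
        ContDiffAt ℝ (M + 1 : ℕ) P.gD p → ContDiffAt ℝ M P.gN p →
        ∀ q' ∈ EllipticInterface.LamV1 (M + 1),
          P.derivMinus P.u p q' =
            (∑ q ∈ EllipticInterface.LamV1 (M + 1) with q.1 + q.2 ≤ q'.1 + q'.2,
              TuPlus (P.jet M p r s) q' q * P.derivPlus P.u p q)
            + (∑ q ∈ EllipticInterface.Lam (M - 1),
              (TfPlus (P.jet M p r s) q' q * P.derivPlus P.f p q
                + TfMinus (P.jet M p r s) q' q * P.derivMinus P.f p q))
            + (∑ q ∈ EllipticInterface.Lam (M + 1),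
              TgD (P.jet M p r s) q' q * EllipticInterface.pderiv q P.gD p)
            + ∑ q ∈ EllipticInterface.Lam M,
              P.orientation p r s * TgN (P.jet M p r s) q' q
                * EllipticInterface.pderiv q P.gN p) ∧
      -- coefficients of top order depend only on the curve and on the two values of `a`
      (∀ J J' : EllipticInterface.Jet M, J.r = J'.r → J.s = J'.s →
        J.aPlus (EllipticInterface.origin M) = J'.aPlus (EllipticInterface.origin M) →
        J.aMinus (EllipticInterface.origin M) = J'.aMinus (EllipticInterface.origin M) →
        ∀ q' ∈ EllipticInterface.LamV1 (M + 1), ∀ q ∈ EllipticInterface.LamV1 (M + 1),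
          q.1 + q.2 = q'.1 + q'.2 → TuPlus J q' q = TuPlus J' q' q) ∧
      -- the coefficients of `u_+^{(0,0)}`
      (∀ J : EllipticInterface.Jet M,
        TuPlus J (0, 0) (0, 0) = 1 ∧
        ∀ q' ∈ EllipticInterface.LamV1 (M + 1), q' ≠ (0, 0) → TuPlus J q' (0, 0) = 0) := by
  choose c htrans htop hzero using EllipticInterface.Jet.exists_coeffs (M := M)
  refine ⟨fun J q' => c J q' .uPlus, fun J q' => c J q' .fPlus, fun J q' => c J q' .fMinus,
    fun J q' => c J q' .gD, fun J q' => c J q' .gN, ?_, ?_, fun J => ⟨?_, fun q' _ => hzero J q'⟩⟩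
  · intro P p r s hP _ hl hD hN q' hq'
    simp only [mul_assoc, mul_left_comm (P.orientation p r s)]
    exact htrans _ q' (hP.jet_regular hl) hq' _ (hP.transmits hl hD hN)
  · intro J J' hr hs hplus hminus q' _ q _ hq
    exact (htop J q' q hq).trans <|
      EllipticInterface.Jet.topCoeff_congr hr hs hplus hminus ▸ (htop J' q' q hq).symm
  · exact (htop J (0, 0) (0, 0) rfl).trans J.topCoeff_zero
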